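/- **Theorem 3.1.** Let $D=\{z\in\mathbb C:|z|<1\}$ and let $H(D)$ be the set of analytic functions on $D$. For $0<\alpha<\infty$ let $\mathcal Z^\alpha$ be the Banach space of all $f\in H(D)$ with $$\|f\|_{\mathcal Z^\alpha}=|f(0)|+|f'(0)|+\sup_{z\in D}(1-|z|^2)^\alpha|f''(z)|<\infty ,$$ and for $\beta>0$ and $u\in H(D)$ put $\|u\|_{v_\beta}=\sup_{z\in D}(1-|z|^2)^\beta|u(z)|\in[0,\infty]$. For a bounded linear operator $T:X\to Y$ between normed spaces let $$\|T\|_{e,X\to Y}=\inf\{\|T+K\|_{X\to Y}: K:X\to Y \text{ linear and compact}\}$$ be its essential norm. For an analytic map $\varphi:D\to D$ and $g\in H(D)$ let $$(V_gC_\varphi f)(z)=\int_0^z f'(\varphi(\xi))\,g(\xi)\,d\xi ,\qquad z\in D .$$ Let $\alpha,\beta>0$. There are constants $C_1,C_2>0$, depending only on $\alpha$ and $\beta$, such that for every analytic $\varphi:D\to D$ and every $g\in H(D)$ for which $V_gC_\varphi:\mathcal Z^\alpha\to\mathcal Z^\beta$ is a bounded operator, $$C_1\,\|V_gC_\varphi\|_{e,\mathcal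 Z^\alpha\to\mathcal Z^\beta}\le L\le C_2\,\|V_gC_\varphi\|_{e,\mathcal Z^\alpha\to\mathcal Z^\beta},$$ where (i) if $0<\alpha<1$, $\displaystyle L=\limsup_{n\to\infty}(n+1)^\alpha\|g\varphi'\varphi^n\|_{v_\beta}$; (ii) if $\alpha=1$, $\displaystyle L=\max\Big\{\limsup_{n\to\infty}(n+1)\|g\varphi'\varphi^n\|_{v_\beta},\ \limsup_{n\to\infty}(\log n)\|g'\varphi^n\|_{v_\beta}\Big\}$; (iii) if $\alpha>1$, $\displaystyle L=\max\Big\{\limsup_{n\to\infty}(n+1)^\alpha\|g\varphi'\varphi^n\|_{v_\beta},\ \limsup_{n\to\infty}(n+1)^{\alpha-1}\|g'\varphi^n\|_{v_\beta}\Big\}$. Here $\varphi^n$ is the $n$-th power of $\varphi$. -/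

import Mathlib

open Filter Metric
open scoped ENNReal NNReal

noncomputable section

/-- The norm `‖u‖_{v_β} = sup_{|z| < 1} (1 - |z|²)^β |u(z)|`, as an extended nonnegative real
(it is `∞` exactly when the set of values is unbounded). -/
def weightedSup (β : ℝ) (u : ℂ → ℂ) : ℝ≥0∞ :=
  ⨆ z ∈ ball (0 : ℂ) 1, ENNReal.ofReal ((1 - ‖z‖ ^ 2) ^ β) * ‖u z‖ₑ

theorem weightedSup_congr (β : ℝ) {u w : ℂ → ℂ} (h : ∀ z ∈ ball (0 : ℂ) 1, u z = w z) :
    weightedSup β u = weightedSup β w :=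
  iSup_congr fun z => iSup_congr fun hz => by rw [h z hz]

theorem weightedSup_zero (β : ℝ) : weightedSup β (fun _ => 0) = 0 := by
  simp [weightedSup]

theorem weightedSup_add_le (β : ℝ) (u w : ℂ → ℂ) :
    weightedSup β (fun z => u z + w z) ≤ weightedSup β u + weightedSup β w := by
  refine iSup₂_le fun z hz => ?_
  calc ENNReal.ofReal ((1 - ‖z‖ ^ 2) ^ β) * ‖u z + w z‖ₑ
      ≤ ENNReal.ofReal ((1 - ‖z‖ ^ 2) ^ β) * (‖u z‖ₑ + ‖w z‖ₑ) := by
        gcongr; exact enorm_add_le _ _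
    _ = ENNReal.ofReal ((1 - ‖z‖ ^ 2) ^ β) * ‖u z‖ₑ
          + ENNReal.ofReal ((1 - ‖z‖ ^ 2) ^ β) * ‖w z‖ₑ := mul_add _ _ _
    _ ≤ _ := add_le_add
        (le_iSup₂ (f := fun z (_ : z ∈ ball (0 : ℂ) 1) =>
          ENNReal.ofReal ((1 - ‖z‖ ^ 2) ^ β) * ‖u z‖ₑ) z hz)
        (le_iSup₂ (f := fun z (_ : z ∈ ball (0 : ℂ) 1) =>
          ENNReal.ofReal ((1 - ‖z‖ ^ 2) ^ β) * ‖w z‖ₑ) z hz)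

theorem weightedSup_smul (β : ℝ) (c : ℂ) (u : ℂ → ℂ) :
    weightedSup β (fun z => c * u z) = ‖c‖ₑ * weightedSup β u := by
  simp only [weightedSup, ENNReal.mul_iSup, enorm_mul]
  refine iSup_congr fun z => iSup_congr fun _ => ?_
  ring

theorem eq_zero_of_weightedSup_eq_zero {β : ℝ} {u : ℂ → ℂ} (h : weightedSup β u = 0)
    {z : ℂ} (hz : z ∈ ball (0 : ℂ) 1) : u z = 0 := by
  have h1 := le_iSup₂ (f := fun z (_ : z ∈ ball (0 : ℂ) 1) =>
          ENNReal.ofReal ((1 - ‖z‖ ^ 2) ^ β) * ‖u z‖ₑ) z hz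
  have h2 : ENNReal.ofReal ((1 - ‖z‖ ^ 2) ^ β) * ‖u z‖ₑ = 0 :=
    le_antisymm (h1.trans h.le) bot_le
  have hz' : ‖z‖ < 1 := by simpa using hz
  have hpos : 0 < (1 - ‖z‖ ^ 2) ^ β :=
    Real.rpow_pos_of_pos (by nlinarith [norm_nonneg z]) _
  rcases mul_eq_zero.1 h2 with h3 | h3
  · exact absurd (ENNReal.ofReal_eq_zero.1 h3) (not_le.2 hpos)
  · simpa using h3

theorem deriv_add_disk {f h : ℂ → ℂ} (hf : DifferentiableOn ℂ f (ball 0 1))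
    (hh : DifferentiableOn ℂ h (ball 0 1)) {z : ℂ} (hz : z ∈ ball (0 : ℂ) 1) :
    deriv (f + h) z = deriv f z + deriv h z :=
  deriv_add (hf.differentiableAt (isOpen_ball.mem_nhds hz))
    (hh.differentiableAt (isOpen_ball.mem_nhds hz))

theorem deriv2_add_disk {f h : ℂ → ℂ} (hf : DifferentiableOn ℂ f (ball 0 1))
    (hh : DifferentiableOn ℂ h (ball 0 1)) {z : ℂ} (hz : z ∈ ball (0 : ℂ) 1) :
    deriv (deriv (f + h)) z = deriv (deriv f) z + deriv (deriv h) z := by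
  have h1 : deriv (f + h) =ᶠ[nhds z] deriv f + deriv h :=
    Filter.eventuallyEq_of_mem (isOpen_ball.mem_nhds hz) fun w hw => deriv_add_disk hf hh hw
  rw [h1.deriv_eq]
  exact deriv_add_disk (hf.deriv isOpen_ball) (hh.deriv isOpen_ball) hz

theorem deriv_smul_disk (c : ℂ) (f : ℂ → ℂ) :
    deriv (c • f) = c • deriv f := by
  funext z
  exact deriv_const_smul_field c f

theorem deriv2_smul_disk (c : ℂ) (f : ℂ → ℂ) (z : ℂ) :
    deriv (deriv (c • f)) z = c * deriv (deriv f) z := by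
  rw [deriv_smul_disk, deriv_smul_disk]; rfl

/-- The vector space underlying `𝓩^α`. A function on the open unit disk is represented by its
extension by `0` to `ℂ`, so that elements are equal iff they agree on the disk. -/
def zygmundSubmodule (α : ℝ) : Submodule ℂ (ℂ → ℂ) where
  carrier := {f | DifferentiableOn ℂ f (ball 0 1) ∧ (∀ z ∉ ball (0 : ℂ) 1, f z = 0) ∧
    weightedSup α (deriv (deriv f)) < ∞}
  zero_mem' := by
    refine ⟨differentiableOn_const 0, fun _ _ => rfl, ?_⟩
    have : deriv (deriv (0 : ℂ → ℂ)) = fun _ => 0 := by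
      funext z; simp
    rw [this, weightedSup_zero]
    exact ENNReal.zero_lt_top
  add_mem' := by
    rintro f h ⟨hf, hf0, hfs⟩ ⟨hh, hh0, hhs⟩
    refine ⟨hf.add hh, fun z hz => by simp [hf0 z hz, hh0 z hz], ?_⟩
    rw [weightedSup_congr α fun z hz => deriv2_add_disk hf hh hz]
    exact (weightedSup_add_le _ _ _).trans_lt (ENNReal.add_lt_top.2 ⟨hfs, hhs⟩)
  smul_mem' := by
    rintro c f ⟨hf, hf0, hfs⟩
    refine ⟨hf.const_smul c, fun z hz => by simp [hf0 z hz], ?_⟩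
    rw [weightedSup_congr α fun z _ => deriv2_smul_disk c f z, weightedSup_smul]
    exact ENNReal.mul_lt_top enorm_lt_top hfs

/-- The Zygmund type space `𝓩^α` of analytic functions `f` on the open unit disk with
`sup_{|z| < 1} (1 - |z|²)^α |f''(z)| < ∞`. -/
def Zygmund (α : ℝ) : Type := zygmundSubmodule α

namespace Zygmund

variable {α : ℝ}

instance : AddCommGroup (Zygmund α) := inferInstanceAs (AddCommGroup (zygmundSubmodule α))

instance : Module ℂ (Zygmund α) := inferInstanceAs (Module ℂ (zygmundSubmodule α))

/-- The underlying function. -/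
def toFun (f : Zygmund α) : ℂ → ℂ := Subtype.val (p := fun f => f ∈ zygmundSubmodule α) f

instance : CoeFun (Zygmund α) fun _ => ℂ → ℂ := ⟨toFun⟩

theorem coe_add (f h : Zygmund α) : ⇑(f + h) = ⇑f + ⇑h := rfl

theorem coe_smul (c : ℂ) (f : Zygmund α) : ⇑(c • f) = c • ⇑f := rfl

theorem coe_zero : ⇑(0 : Zygmund α) = 0 := rfl

theorem differentiableOn (f : Zygmund α) : DifferentiableOn ℂ f (ball 0 1) :=
  (Subtype.prop (p := fun f => f ∈ zygmundSubmodule α) f).1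

theorem apply_eq_zero (f : Zygmund α) {z : ℂ} (hz : z ∉ ball (0 : ℂ) 1) : f z = 0 :=
  (Subtype.prop (p := fun f => f ∈ zygmundSubmodule α) f).2.1 z hz

theorem weightedSup_lt_top (f : Zygmund α) : weightedSup α (deriv (deriv f)) < ∞ :=
  (Subtype.prop (p := fun f => f ∈ zygmundSubmodule α) f).2.2

theorem ext_fun {f h : Zygmund α} (hfh : (f : ℂ → ℂ) = h) : f = h := Subtype.ext hfh

/-- The norm `‖f‖_{𝓩^α} = |f(0)| + |f'(0)| + sup_{|z| < 1} (1 - |z|²)^α |f''(z)|`. -/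
instance : Norm (Zygmund α) :=
  ⟨fun f => ‖f 0‖ + ‖deriv f 0‖ + (weightedSup α (deriv (deriv f))).toReal⟩

theorem norm_def (f : Zygmund α) :
    ‖f‖ = ‖f 0‖ + ‖deriv f 0‖ + (weightedSup α (deriv (deriv f))).toReal := rfl

theorem norm_smul_eq (c : ℂ) (f : Zygmund α) : ‖c • f‖ = ‖c‖ * ‖f‖ := by
  rw [norm_def, norm_def, coe_smul, weightedSup_congr α fun z _ => deriv2_smul_disk c f z,
    weightedSup_smul, deriv_smul_disk]
  simp [ENNReal.toReal_mul]
  ring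

theorem norm_add_le' (f h : Zygmund α) : ‖f + h‖ ≤ ‖f‖ + ‖h‖ := by
  have h0 : (0 : ℂ) ∈ ball (0 : ℂ) 1 := by simp
  have h1 : (weightedSup α (deriv (deriv (⇑(f + h))))).toReal ≤
      (weightedSup α (deriv (deriv f))).toReal + (weightedSup α (deriv (deriv h))).toReal := by
    rw [← ENNReal.toReal_add f.weightedSup_lt_top.ne h.weightedSup_lt_top.ne]
    refine ENNReal.toReal_mono
      (ENNReal.add_lt_top.2 ⟨f.weightedSup_lt_top, h.weightedSup_lt_top⟩).ne ?_
    rw [coe_add, weightedSup_congr α fun z hz =>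
      deriv2_add_disk f.differentiableOn h.differentiableOn hz]
    exact weightedSup_add_le _ _ _
  have h2 : ‖(f + h) 0‖ ≤ ‖f 0‖ + ‖h 0‖ := norm_add_le (f 0) (h 0)
  have h3 : ‖deriv (⇑(f + h)) 0‖ ≤ ‖deriv f 0‖ + ‖deriv h 0‖ := by
    rw [coe_add, deriv_add_disk f.differentiableOn h.differentiableOn h0]
    exact norm_add_le _ _
  rw [norm_def, norm_def, norm_def]
  linarith

theorem eq_zero_of_norm_eq_zero (f : Zygmund α) (hf : ‖f‖ = 0) : f = 0 := by
  have h0 : (0 : ℂ) ∈ ball (0 : ℂ) 1 := by simp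
  rw [norm_def] at hf
  have n1 := norm_nonneg (f 0)
  have n2 := norm_nonneg (deriv f 0)
  have n3 : 0 ≤ (weightedSup α (deriv (deriv f))).toReal := ENNReal.toReal_nonneg
  have e1 : f 0 = 0 := norm_eq_zero.1 (by linarith)
  have e2 : deriv f 0 = 0 := norm_eq_zero.1 (by linarith)
  have e3 : weightedSup α (deriv (deriv f)) = 0 := by
    have : (weightedSup α (deriv (deriv f))).toReal = 0 := by linarith
    exact ((ENNReal.toReal_eq_zero_iff _).1 this).resolve_right f.weightedSup_lt_top.ne
  have hpre : IsPreconnected (ball (0 : ℂ) 1) := (convex_ball 0 1).isPreconnected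
  have d1 : ∀ z ∈ ball (0 : ℂ) 1, deriv f z = 0 := fun z hz => by
    rw [← e2]
    exact isOpen_ball.is_const_of_deriv_eq_zero hpre (f.differentiableOn.deriv isOpen_ball)
      (fun w hw => eq_zero_of_weightedSup_eq_zero e3 hw) hz h0
  refine ext_fun (funext fun z => ?_)
  by_cases hz : z ∈ ball (0 : ℂ) 1
  · rw [coe_zero, Pi.zero_apply, ← e1]
    exact isOpen_ball.is_const_of_deriv_eq_zero hpre f.differentiableOn d1 hz h0
  · rw [f.apply_eq_zero hz]; rfl

instance : NormedAddCommGroup (Zygmund α) :=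
  AddGroupNorm.toNormedAddCommGroup
    { toFun := fun f => ‖f‖
      map_zero' := by simpa using norm_smul_eq (0 : ℂ) (0 : Zygmund α)
      add_le' := norm_add_le'
      neg' := fun f => by simpa using norm_smul_eq (-1 : ℂ) f
      eq_zero_of_map_eq_zero' := eq_zero_of_norm_eq_zero }

instance : NormedSpace ℂ (Zygmund α) := ⟨fun c f => (norm_smul_eq c f).le⟩

end Zygmund

/-- `(V_g C_φ f)(z) = ∫_0^z f'(φ(ξ)) g(ξ) dξ`, the integral being taken along the segment
`ξ = t z`, `0 ≤ t ≤ 1`. -/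
def volterraComp (g φ f : ℂ → ℂ) (z : ℂ) : ℂ :=
  z * ∫ t in (0 : ℝ)..1, deriv f (φ (t * z)) * g (t * z)

/-- The essential norm of a bounded operator: its distance to the compact operators. -/
def essNorm {X Y : Type*} [NormedAddCommGroup X] [NormedSpace ℂ X]
    [NormedAddCommGroup Y] [NormedSpace ℂ Y] (T : X →L[ℂ] Y) : ℝ≥0∞ :=
  ⨅ (K : X →L[ℂ] Y) (_ : IsCompactOperator K), ‖T + K‖ₑ

/-- `limsup_{n → ∞} c_n ‖u φ^n‖_{v_β}`. -/
def limsupPow (β : ℝ) (c : ℕ → ℝ) (u φ : ℂ → ℂ) : ℝ≥0∞ :=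
  limsup (fun n : ℕ => ENNReal.ofReal (c n) * weightedSup β (fun z => u z * φ z ^ n)) atTop

end

/-! The image `T f` vanishes at `0`, its derivative is `f'(φ) g`, and `(T f)'' = f''(φ) · gφ' +
f'(φ) · g'`. So everything is a weighted supremum estimate for the two symbols `gφ'` and `g'`. Since
`|f''| ≤ ‖f‖ (1 - |z|²)^(-α)`, radial increments of `f'` are controlled by an antiderivative `ψ` of
`(1 - t)^(-α)`. On `[0, 1)` it can be taken bounded for `α < 1`, equal to `-log (1 - t)` for `α =
1`, and of order `(1 - t)^(1 - α)` for `α > 1`; this is the origin of the three cases.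

Upper bound for the essential norm: a finite rank `Q` imitates the dilation `f' ↦ f'(r ·)`
(`Zygmund.exists_compact_approx`). Then `TQ` is compact, and `f - Q f` is small together with its
first two derivatives' contribution on compact subsets of the disk, so only points with `|φ z|` near
`1` matter (`IsVolterraComp.essNorm_le`). There the symbols are bounded by choosing `n` of order `1
/ (1 - |φ z|)` in the limsup (`exists_pow_ge_half`).

Lower bound: let `f n` have derivatives forming an `IsTestSeq`. The weighted second derivatives
drift to the boundary, so subsequences can be thinned until their partial sums stay bounded
(`exists_strictMono_sum_le`). A compact operator must then send `f n` to zero, by Cesàro means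
(`IsCompactOperator.tendsto_zero_of_bounded_sums`), and the essential norm controls `T (f n)` for
large `n` (`IsVolterraComp.eventually_testSeq_le`). Comparing the monomials of indices `n` and `2n +
1` isolates `g'`, and then `gφ'`. For `α = 1` monomials miss the logarithm, which comes from squares
of truncations of `-log (1 - z)`, rotated towards the relevant values of `φ`. -/

/-! ### Pointwise form of the norms, and elements with prescribed derivative. -/

theorem one_sub_norm_sq_pos {z : ℂ} (hz : z ∈ ball (0 : ℂ) 1) : 0 < 1 - ‖z‖ ^ 2 := by
  have : ‖z‖ < 1 := by simpa using hz
  nlinarith [norm_nonneg z]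

theorem weightedSup_le_ofReal_iff {β c : ℝ} (hc : 0 ≤ c) {u : ℂ → ℂ} :
    weightedSup β u ≤ ENNReal.ofReal c ↔
      ∀ z ∈ ball (0 : ℂ) 1, (1 - ‖z‖ ^ 2) ^ β * ‖u z‖ ≤ c := by
  unfold weightedSup
  rw [iSup₂_le_iff]
  refine forall₂_congr fun z hz => ?_
  rw [← ofReal_norm, ← ENNReal.ofReal_mul (Real.rpow_nonneg (one_sub_norm_sq_pos hz).le _),
    ENNReal.ofReal_le_ofReal_iff hc]

theorem Zygmund.weight_mul_deriv2_le {α : ℝ} (f : Zygmund α) {z : ℂ} (hz : z ∈ ball (0 : ℂ) 1) :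
    (1 - ‖z‖ ^ 2) ^ α * ‖deriv (deriv f) z‖ ≤ ‖f‖ := by
  have h := (weightedSup_le_ofReal_iff (β := α) (u := deriv (deriv f)) ENNReal.toReal_nonneg).1
    (ENNReal.ofReal_toReal f.weightedSup_lt_top.ne).ge z hz
  refine h.trans ?_
  rw [Zygmund.norm_def]
  linarith [norm_nonneg (f 0), norm_nonneg (deriv f 0)]

theorem Zygmund.norm_deriv_zero_le {α : ℝ} (f : Zygmund α) : ‖deriv f 0‖ ≤ ‖f‖ := by
  rw [Zygmund.norm_def]
  linarith [norm_nonneg (f 0), ENNReal.toReal_nonneg (a := weightedSup α (deriv (deriv f)))]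

theorem Zygmund.norm_le_of_forall {α c : ℝ} (f : Zygmund α) (hc : 0 ≤ c)
    (h : ∀ z ∈ ball (0 : ℂ) 1, (1 - ‖z‖ ^ 2) ^ α * ‖deriv (deriv f) z‖ ≤ c) :
    ‖f‖ ≤ ‖f 0‖ + ‖deriv f 0‖ + c := by
  rw [Zygmund.norm_def]
  gcongr
  exact ENNReal.toReal_le_of_le_ofReal hc ((weightedSup_le_ofReal_iff hc).2 h)

theorem Zygmund.differentiableAt_deriv {α : ℝ} (f : Zygmund α) {z : ℂ}
    (hz : z ∈ ball (0 : ℂ) 1) : DifferentiableAt ℂ (deriv f) z :=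
  (f.differentiableOn.deriv isOpen_ball).differentiableAt (isOpen_ball.mem_nhds hz)

theorem Zygmund.norm_deriv2_le {α : ℝ} (f : Zygmund α) {z : ℂ} (hz : z ∈ ball (0 : ℂ) 1) :
    ‖deriv (deriv f) z‖ ≤ ‖f‖ * (1 - ‖z‖ ^ 2) ^ (-α) := by
  rw [Real.rpow_neg (one_sub_norm_sq_pos hz).le, ← div_eq_mul_inv,
    le_div_iff₀ (Real.rpow_pos_of_pos (one_sub_norm_sq_pos hz) _), mul_comm]
  exact f.weight_mul_deriv2_le hz

/-- The derivative at a point of the disk, as a linear functional. -/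
noncomputable def Zygmund.derivEval (α : ℝ) {z : ℂ} (hz : z ∈ ball (0 : ℂ) 1) : Zygmund α →ₗ[ℂ] ℂ where
  toFun f := deriv f z
  map_add' f h := by
    rw [Zygmund.coe_add, deriv_add_disk f.differentiableOn h.differentiableOn hz]
  map_smul' c f := by
    rw [Zygmund.coe_smul, deriv_smul_disk]; rfl

theorem Zygmund.deriv_sub {α : ℝ} (f h : Zygmund α) {z : ℂ} (hz : z ∈ ball (0 : ℂ) 1) :
    deriv (f - h : Zygmund α) z = deriv f z - deriv h z :=
  map_sub (Zygmund.derivEval α hz) f h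

open Classical in
/-- Every entire function is, on the disk, the derivative of an element of `𝓩^α`. -/
theorem Zygmund.exists_deriv_eq {α : ℝ} (hα : 0 < α) {F : ℂ → ℂ} (hF : Differentiable ℂ F) :
    ∃ f : Zygmund α, f 0 = 0 ∧ ∀ z ∈ ball (0 : ℂ) 1, deriv f z = F z ∧
      deriv (deriv f) z = deriv F z := by
  obtain ⟨G, hG0, hG⟩ := hF.isExactOn_univ.with_val_at (0 : ℂ) (0 : ℂ)
  have hev : ∀ z ∈ ball (0 : ℂ) 1, (fun z => if z ∈ ball (0 : ℂ) 1 then G z else 0) =ᶠ[nhds z] G :=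
    fun z hz => Filter.eventuallyEq_of_mem (isOpen_ball.mem_nhds hz) fun w hw => if_pos hw
  have hd : ∀ z ∈ ball (0 : ℂ) 1,
      deriv (fun z => if z ∈ ball (0 : ℂ) 1 then G z else 0) z = F z := fun z hz => by
    rw [(hev z hz).deriv_eq]; exact (hG z trivial).deriv
  have hd2 : ∀ z ∈ ball (0 : ℂ) 1,
      deriv (deriv (fun z => if z ∈ ball (0 : ℂ) 1 then G z else 0)) z = deriv F z :=
    fun z hz => Filter.EventuallyEq.deriv_eq
      (Filter.eventuallyEq_of_mem (isOpen_ball.mem_nhds hz) hd)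
  obtain ⟨C, hC⟩ := (isCompact_closedBall (0 : ℂ) 1).exists_bound_of_continuousOn
    (hF.contDiff (n := 1)).continuous_deriv_one.continuousOn
  have hC0 : 0 ≤ C := (norm_nonneg _).trans (hC 0 (by simp))
  refine ⟨⟨fun z => if z ∈ ball (0 : ℂ) 1 then G z else 0, ?_, fun z hz => if_neg hz, ?_⟩, ?_,
    fun z hz => ⟨hd z hz, hd2 z hz⟩⟩
  · exact fun z hz => (((hG z trivial).differentiableAt).congr_of_eventuallyEq
      (hev z hz)).differentiableWithinAt
  · rw [weightedSup_congr α hd2]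
    refine lt_of_le_of_lt ((weightedSup_le_ofReal_iff hC0).2 fun z hz => ?_)
      (ENNReal.ofReal_lt_top (r := C))
    calc (1 - ‖z‖ ^ 2) ^ α * ‖deriv F z‖ ≤ 1 * C := by
          gcongr
          · exact Real.rpow_le_one (one_sub_norm_sq_pos hz).le (by nlinarith [norm_nonneg z]) hα.le
          · exact hC z (ball_subset_closedBall hz)
      _ = C := one_mul C
  · change (if (0 : ℂ) ∈ ball (0 : ℂ) 1 then G 0 else 0) = 0
    simp [hG0]

/-! ### Derivatives of the Volterra composition operator. -/

/-- The integrand is analytic on the disk and so has a primitive `H` there; the integral along the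
segment is `H w - H 0`. -/
theorem deriv_volterraComp {φ g f : ℂ → ℂ} (hφ : DifferentiableOn ℂ φ (ball 0 1))
    (hm : Set.MapsTo φ (ball 0 1) (ball 0 1)) (hg : DifferentiableOn ℂ g (ball 0 1))
    (hf : DifferentiableOn ℂ f (ball 0 1)) {z : ℂ} (hz : z ∈ ball (0 : ℂ) 1) :
    HasDerivAt (volterraComp g φ f) (deriv f (φ z) * g z) z := by
  have hh : DifferentiableOn ℂ (fun z => deriv f (φ z) * g z) (ball 0 1) :=
    ((hf.deriv isOpen_ball).comp hφ hm).mul hg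
  obtain ⟨H, hH⟩ := hh.isExactOn_ball
  have key : ∀ w ∈ ball (0 : ℂ) 1, volterraComp g φ f w = H w - H 0 := by
    intro w hw
    have hmem : ∀ t ∈ Set.uIcc (0 : ℝ) 1, (t : ℂ) * w ∈ ball (0 : ℂ) 1 := by
      intro t ht
      rw [Set.uIcc_of_le zero_le_one] at ht
      rw [mem_ball_zero_iff] at hw ⊢
      rw [norm_mul, Complex.norm_real, Real.norm_of_nonneg ht.1]
      nlinarith [norm_nonneg w, ht.2]
    have hcont : ContinuousOn (fun t : ℝ => deriv f (φ (t * w)) * g (t * w))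
        (Set.uIcc (0 : ℝ) 1) :=
      hh.continuousOn.comp (by fun_prop) hmem
    have := intervalIntegral.integral_eq_sub_of_hasDerivAt (a := 0) (b := 1)
      (f := fun t : ℝ => H (t * w)) (f' := fun t : ℝ => w * (deriv f (φ (t * w)) * g (t * w)))
      (fun t ht => by
        have h1 := hH _ (hmem t ht)
        have h2 : HasDerivAt (fun t : ℝ => (t : ℂ) * w) (1 * w) t :=
          (HasDerivAt.ofReal_comp (hasDerivAt_id t)).mul_const w
        have := h1.scomp t h2
        simpa [Function.comp_def] using this)
      ((continuousOn_const.mul hcont).intervalIntegrable)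
    rw [intervalIntegral.integral_const_mul] at this
    simpa [volterraComp] using this
  have h1 : volterraComp g φ f =ᶠ[nhds z] fun w => H w - H 0 :=
    Filter.eventuallyEq_of_mem (isOpen_ball.mem_nhds hz) key
  exact ((hH z hz).sub_const _).congr_of_eventuallyEq h1

/-- `T` acts as `V_g C_φ`, for `φ` an analytic self-map of the disk and `g` analytic. -/
structure IsVolterraComp {α β : ℝ} (g φ : ℂ → ℂ) (T : Zygmund α →L[ℂ] Zygmund β) : Prop where
  self_map : DifferentiableOn ℂ φ (ball 0 1)
  mapsTo : Set.MapsTo φ (ball 0 1) (ball 0 1)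
  symbol : DifferentiableOn ℂ g (ball 0 1)
  apply_eq : ∀ f : Zygmund α, ∀ z ∈ ball (0 : ℂ) 1, T f z = volterraComp g φ f z

namespace IsVolterraComp

variable {α β : ℝ} {g φ : ℂ → ℂ} {T : Zygmund α →L[ℂ] Zygmund β}

theorem apply_zero (hT : IsVolterraComp g φ T) (f : Zygmund α) : T f 0 = 0 := by
  rw [hT.apply_eq f 0 (by simp)]; simp [volterraComp]

theorem deriv_apply (hT : IsVolterraComp g φ T) (f : Zygmund α) {z : ℂ}
    (hz : z ∈ ball (0 : ℂ) 1) : deriv (T f) z = deriv f (φ z) * g z := by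
  have h : (T f : ℂ → ℂ) =ᶠ[nhds z] volterraComp g φ f :=
    Filter.eventuallyEq_of_mem (isOpen_ball.mem_nhds hz) (hT.apply_eq f)
  rw [h.deriv_eq]
  exact (deriv_volterraComp hT.self_map hT.mapsTo hT.symbol f.differentiableOn hz).deriv

theorem deriv2_apply (hT : IsVolterraComp g φ T) (f : Zygmund α) {z : ℂ}
    (hz : z ∈ ball (0 : ℂ) 1) : deriv (deriv (T f)) z =
      deriv (deriv f) (φ z) * (g z * deriv φ z) + deriv f (φ z) * deriv g z := by
  have h : deriv (T f) =ᶠ[nhds z] fun z => deriv f (φ z) * g z :=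
    Filter.eventuallyEq_of_mem (isOpen_ball.mem_nhds hz) fun w hw => hT.deriv_apply f hw
  rw [h.deriv_eq]
  have h1 : HasDerivAt (fun z => deriv f (φ z)) (deriv (deriv f) (φ z) * deriv φ z) z :=
    (f.differentiableAt_deriv (hT.mapsTo hz)).hasDerivAt.comp z
      (hT.self_map.differentiableAt (isOpen_ball.mem_nhds hz)).hasDerivAt
  have h2 := (hT.symbol.differentiableAt (isOpen_ball.mem_nhds hz)).hasDerivAt
  rw [(h1.fun_mul h2).deriv]
  ring

theorem norm_apply_le (hT : IsVolterraComp g φ T) (f : Zygmund α) {c d : ℝ} (hc : 0 ≤ c)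
    (hd : ‖deriv f (φ 0)‖ * ‖g 0‖ ≤ d)
    (h : ∀ z ∈ ball (0 : ℂ) 1, (1 - ‖z‖ ^ 2) ^ β *
      ‖deriv (deriv f) (φ z) * (g z * deriv φ z) + deriv f (φ z) * deriv g z‖ ≤ c) :
    ‖T f‖ ≤ d + c := by
  refine ((T f).norm_le_of_forall hc fun z hz => ?_).trans ?_
  · rw [hT.deriv2_apply f hz]; exact h z hz
  · rw [hT.apply_zero, hT.deriv_apply f (by simp), norm_zero, zero_add, norm_mul]
    gcongr

theorem weight_mul_le (hT : IsVolterraComp g φ T) (f : Zygmund α) {z : ℂ}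
    (hz : z ∈ ball (0 : ℂ) 1) : (1 - ‖z‖ ^ 2) ^ β *
      ‖deriv (deriv f) (φ z) * (g z * deriv φ z) + deriv f (φ z) * deriv g z‖ ≤ ‖T f‖ := by
  rw [← hT.deriv2_apply f hz]
  exact (T f).weight_mul_deriv2_le hz

/-- Boundedness of the operator forces `‖g'‖_{v_β} < ∞` and `‖g φ'‖_{v_β} < ∞`. -/
theorem exists_bound (hα : 0 < α) (hT : IsVolterraComp g φ T) : ∃ M : ℝ, 0 < M ∧
    ∀ z ∈ ball (0 : ℂ) 1, (1 - ‖z‖ ^ 2) ^ β * ‖g z * deriv φ z‖ ≤ M ∧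
      (1 - ‖z‖ ^ 2) ^ β * ‖deriv g z‖ ≤ M := by
  -- Test on `f' = 1`, which yields `g'`, and on `f' = z`, which yields `gφ' + φ g'`; the term `φ
  -- g'` is removed using `|φ| ≤ 1`.
  obtain ⟨f₁, -, h₁⟩ := Zygmund.exists_deriv_eq hα (differentiable_const (1 : ℂ))
  obtain ⟨f₂, -, h₂⟩ := Zygmund.exists_deriv_eq hα (F := fun z : ℂ => z) differentiable_id
  refine ⟨‖T f₁‖ + ‖T f₂‖ + 1, by positivity, fun z hz => ?_⟩
  have a := hT.weight_mul_le f₁ hz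
  have b := hT.weight_mul_le f₂ hz
  rw [(h₁ _ (hT.mapsTo hz)).1, (h₁ _ (hT.mapsTo hz)).2] at a
  rw [(h₂ _ (hT.mapsTo hz)).1, (h₂ _ (hT.mapsTo hz)).2] at b
  simp only [deriv_const', deriv_id'', zero_mul, zero_add, one_mul] at a b
  have hw : 0 ≤ (1 - ‖z‖ ^ 2) ^ β := Real.rpow_nonneg (one_sub_norm_sq_pos hz).le _
  refine ⟨?_, by linarith [norm_nonneg (T f₂)]⟩
  have hφ : ‖φ z‖ ≤ 1 := (mem_ball_zero_iff.1 (hT.mapsTo hz)).le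
  have c : ‖g z * deriv φ z‖ ≤ ‖g z * deriv φ z + φ z * deriv g z‖ + ‖deriv g z‖ := by
    calc ‖g z * deriv φ z‖ = ‖(g z * deriv φ z + φ z * deriv g z) - φ z * deriv g z‖ := by
          congr 1; ring
      _ ≤ ‖g z * deriv φ z + φ z * deriv g z‖ + ‖φ z * deriv g z‖ := norm_sub_le _ _
      _ ≤ _ := by
          rw [norm_mul (φ z)]
          gcongr
          exact mul_le_of_le_one_left (norm_nonneg _) hφ
  nlinarith [mul_le_mul_of_nonneg_left c hw]

end IsVolterraComp

/-! ### Growth of derivatives and compact approximation of the identity. -/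

/-- Growth of the derivative: if `ψ' = (1 - t)^{-α}` on `[0, 1)`, then `ψ` controls the
radial increments of `f'` for `f ∈ 𝓩^α`. -/
theorem Zygmund.norm_deriv_sub_deriv_le {α : ℝ} (hα : 0 < α) {ψ : ℝ → ℝ}
    (hψ : ∀ t, 0 ≤ t → t < 1 → HasDerivAt ψ ((1 - t) ^ (-α)) t) (f : Zygmund α) {z : ℂ}
    (hz : z ∈ ball (0 : ℂ) 1) {s : ℝ} (hs : 0 ≤ s) (hs1 : s ≤ 1) :
    ‖deriv f z - deriv f (s * z)‖ ≤ ‖f‖ * (ψ ‖z‖ - ψ (s * ‖z‖)) := by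
  have hz1 : ‖z‖ < 1 := by simpa using hz
  have hmem : ∀ t ∈ Set.Icc s 1, t * ‖z‖ < 1 := fun t ht => by
    nlinarith [norm_nonneg z, ht.2]
  have hmem' : ∀ t ∈ Set.Icc s 1, (t : ℂ) * z ∈ ball (0 : ℂ) 1 := fun t ht => by
    rw [mem_ball_zero_iff, norm_mul, Complex.norm_real, Real.norm_of_nonneg (hs.trans ht.1)]
    exact hmem t ht
  have hder : ∀ t ∈ Set.Icc s 1, HasDerivAt (fun t : ℝ => deriv f (t * z) - deriv f (s * z))
      (z * deriv (deriv f) (t * z)) t := fun t ht => by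
    have h1 := (f.differentiableAt_deriv (hmem' t ht)).hasDerivAt
    have h2 : HasDerivAt (fun t : ℝ => (t : ℂ) * z) (1 * z) t :=
      (HasDerivAt.ofReal_comp (hasDerivAt_id t)).mul_const z
    have := (h1.scomp t h2).sub_const (deriv f (s * z))
    simpa [Function.comp_def] using this
  have hB : ∀ t ∈ Set.Icc s 1, HasDerivAt (fun t : ℝ => ‖f‖ * (ψ (t * ‖z‖) - ψ (s * ‖z‖)))
      (‖f‖ * ((1 - t * ‖z‖) ^ (-α) * ‖z‖)) t := fun t ht => by
    have h1 := hψ (t * ‖z‖) (mul_nonneg (hs.trans ht.1) (norm_nonneg z)) (hmem t ht)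
    have h2 : HasDerivAt (fun t : ℝ => t * ‖z‖) (1 * ‖z‖) t := (hasDerivAt_id t).mul_const _
    have := ((h1.comp t h2).sub_const (ψ (s * ‖z‖))).const_mul ‖f‖
    simpa [Function.comp_def] using this
  -- Compare along the radius `t ↦ t z`, using `(1 - t²|z|²)^(-α) ≤ (1 - t|z|)^(-α)`.
  have := image_norm_le_of_norm_deriv_right_le_deriv_boundary' (a := s) (b := 1)
    (f := fun t : ℝ => deriv f (t * z) - deriv f (s * z))
    (f' := fun t => z * deriv (deriv f) (t * z))
    (B := fun t : ℝ => ‖f‖ * (ψ (t * ‖z‖) - ψ (s * ‖z‖)))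
    (B' := fun t => ‖f‖ * ((1 - t * ‖z‖) ^ (-α) * ‖z‖))
    (fun t ht => (hder t ht).continuousAt.continuousWithinAt)
    (fun t ht => (hder t (Set.Ico_subset_Icc_self ht)).hasDerivWithinAt)
    (by simp)
    (fun t ht => (hB t ht).continuousAt.continuousWithinAt)
    (fun t ht => (hB t (Set.Ico_subset_Icc_self ht)).hasDerivWithinAt)
    (fun t ht => by
      have ht' := Set.Ico_subset_Icc_self ht
      have h1 := f.norm_deriv2_le (hmem' t ht')
      have h2 : ‖(t : ℂ) * z‖ = t * ‖z‖ := by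
        rw [norm_mul, Complex.norm_real, Real.norm_of_nonneg (hs.trans ht.1)]
      rw [h2] at h1
      have h0 : 0 ≤ t * ‖z‖ := mul_nonneg (hs.trans ht.1) (norm_nonneg z)
      have h3 : (1 - (t * ‖z‖) ^ 2) ^ (-α) ≤ (1 - t * ‖z‖) ^ (-α) :=
        Real.rpow_le_rpow_of_nonpos (by linarith [hmem t ht']) (by nlinarith [hmem t ht'])
          (by linarith)
      calc ‖z * deriv (deriv f) (t * z)‖ = ‖z‖ * ‖deriv (deriv f) (t * z)‖ := norm_mul _ _
        _ ≤ ‖z‖ * (‖f‖ * (1 - t * ‖z‖) ^ (-α)) := by gcongr; exact h1.trans (by gcongr)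
        _ = _ := by ring)
    (x := 1) ⟨hs1, le_rfl⟩
  simpa using this

namespace Zygmund

variable {α : ℝ}

theorem norm_deriv_sub_le (hα : 0 < α) (f : Zygmund α) {σ : ℝ} (hσ : σ < 1) {z w : ℂ}
    (hz : ‖z‖ ≤ σ) (hw : ‖w‖ ≤ σ) :
    ‖deriv f z - deriv f w‖ ≤ ‖f‖ * (1 - σ ^ 2) ^ (-α) * ‖z - w‖ := by
  have hσ0 : 0 ≤ σ := (norm_nonneg z).trans hz
  have hsub : ∀ x ∈ closedBall (0 : ℂ) σ, x ∈ ball (0 : ℂ) 1 := fun x hx => by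
    simp only [mem_closedBall_zero_iff, mem_ball_zero_iff] at hx ⊢; linarith
  refine (convex_closedBall (0 : ℂ) σ).norm_image_sub_le_of_norm_deriv_le
    (fun x hx => f.differentiableAt_deriv (hsub x hx)) (fun x hx => ?_)
    (mem_closedBall_zero_iff.2 hw) (mem_closedBall_zero_iff.2 hz)
  refine (f.norm_deriv2_le (hsub x hx)).trans ?_
  have hx' : ‖x‖ ≤ σ := mem_closedBall_zero_iff.1 hx
  gcongr ?_ * ?_
  exact Real.rpow_le_rpow_of_nonpos (by nlinarith) (by nlinarith [norm_nonneg x]) (by linarith)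

theorem norm_deriv_le (hα : 0 < α) (f : Zygmund α) {σ : ℝ} (hσ : σ < 1) {z : ℂ}
    (hz : ‖z‖ ≤ σ) : ‖deriv f z‖ ≤ (1 + (1 - σ ^ 2) ^ (-α)) * ‖f‖ := by
  have hσ0 : 0 ≤ σ := (norm_nonneg z).trans hz
  have h1 := f.norm_deriv_sub_le hα hσ hz (w := 0) (by simpa using hσ0)
  have h2 := f.norm_deriv_zero_le
  have h3 : ‖deriv f z‖ ≤ ‖deriv f z - deriv f 0‖ + ‖deriv f 0‖ := by
    simpa using norm_add_le (deriv f z - deriv f 0) (deriv f 0)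
  have h4 : 0 ≤ (1 - σ ^ 2) ^ (-α) := Real.rpow_nonneg (by nlinarith) _
  have h5 : ‖f‖ * (1 - σ ^ 2) ^ (-α) * ‖z - 0‖ ≤ ‖f‖ * (1 - σ ^ 2) ^ (-α) * 1 := by
    gcongr
    rw [sub_zero]; linarith
  nlinarith

/-- Cauchy's estimate on the circle of radius `σ`. Keeping `σ` free lets it be taken close to `1`,
which makes the Taylor series converge geometrically on any smaller disk. -/
theorem norm_iteratedDeriv_deriv_le (hα : 0 < α) (k : ℕ) (f : Zygmund α) {σ : ℝ} (hσ0 : 0 < σ)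
    (hσ : σ < 1) : ‖((k.factorial : ℂ)⁻¹ * iteratedDeriv k (deriv f) 0)‖ ≤
      (1 + (1 - σ ^ 2) ^ (-α)) / σ ^ k * ‖f‖ := by
  have h := Complex.norm_iteratedDeriv_le_of_forall_mem_sphere_norm_le (c := 0) (f := deriv f)
    (C := (1 + (1 - σ ^ 2) ^ (-α)) * ‖f‖) k hσ0
    (((f.differentiableOn.deriv isOpen_ball).mono
      (closedBall_subset_ball hσ)).diffContOnCl_ball subset_rfl)
    (fun z hz => f.norm_deriv_le hα hσ (mem_sphere_zero_iff_norm.1 hz).le)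
  have hk : (0 : ℝ) < k.factorial := by exact_mod_cast k.factorial_pos
  rw [norm_mul, norm_inv, Complex.norm_natCast]
  calc (k.factorial : ℝ)⁻¹ * ‖iteratedDeriv k (deriv f) 0‖
      ≤ (k.factorial : ℝ)⁻¹ * (k.factorial * ((1 + (1 - σ ^ 2) ^ (-α)) * ‖f‖) / σ ^ k) := by
        gcongr
    _ = _ := by field_simp

/-- The `k`-th Taylor coefficient of `f'`, as a bounded functional of `f`. -/
noncomputable def derivCoeff (hα : 0 < α) (k : ℕ) : Zygmund α →L[ℂ] ℂ :=
  LinearMap.mkContinuous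
    { toFun := fun f => (k.factorial : ℂ)⁻¹ * iteratedDeriv k (deriv f) 0
      map_add' := fun f h => by
        have hc : ∀ f : Zygmund α, ContDiffAt ℂ ((k + 1 : ℕ) : WithTop ℕ∞) f 0 := fun f =>
          (f.differentiableOn.contDiffOn isOpen_ball).contDiffAt
            (isOpen_ball.mem_nhds (by simp))
        simp only [← iteratedDeriv_succ']
        rw [coe_add, iteratedDeriv_add (hc f) (hc h), mul_add]
      map_smul' := fun c f => by
        rw [coe_smul, deriv_smul_disk, iteratedDeriv_const_smul_field]
        simp only [smul_eq_mul, RingHom.id_apply]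
        ring }
    ((1 + (1 - (1 / 2 : ℝ) ^ 2) ^ (-α)) / (1 / 2) ^ k)
    (fun f => f.norm_iteratedDeriv_deriv_le hα k (by norm_num) (by norm_num))

theorem derivCoeff_apply (hα : 0 < α) (k : ℕ) (f : Zygmund α) :
    derivCoeff hα k f = (k.factorial : ℂ)⁻¹ * iteratedDeriv k (deriv f) 0 := rfl

theorem hasSum_derivCoeff (hα : 0 < α) (f : Zygmund α) {z : ℂ} (hz : z ∈ ball (0 : ℂ) 1) :
    HasSum (fun k => derivCoeff hα k f * z ^ k) (deriv f z) := by
  have h := Complex.hasSum_taylorSeries_on_ball (f.differentiableOn.deriv isOpen_ball) hz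
  have he : (fun k => derivCoeff hα k f * z ^ k) = fun k : ℕ =>
      (k.factorial : ℂ)⁻¹ • (z - 0) ^ k • iteratedDeriv k (deriv f) 0 := by
    funext k
    rw [derivCoeff_apply, smul_eq_mul, smul_eq_mul, sub_zero]
    ring
  rw [he]
  exact h

theorem norm_deriv_sub_sum_le (hα : 0 < α) (f : Zygmund α) {s σ : ℝ} (hs : 0 < s) (hsσ : s < σ)
    (hσ : σ < 1) {z : ℂ} (hz : ‖z‖ ≤ s) (N : ℕ) :
    ‖deriv f z - ∑ k ∈ Finset.range N, derivCoeff hα k f * z ^ k‖ ≤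
      (1 + (1 - σ ^ 2) ^ (-α)) * ‖f‖ * (s / σ) ^ N / (1 - s / σ) := by
  have hσ0 : 0 < σ := hs.trans hsσ
  rw [norm_sub_rev]
  refine norm_sub_le_of_geometric_bound_of_hasSum ((div_lt_one hσ0).2 hsσ) (fun k => ?_)
    (f.hasSum_derivCoeff hα (by rw [mem_ball_zero_iff]; linarith)) N
  rw [norm_mul, norm_pow]
  have h1 := f.norm_iteratedDeriv_deriv_le hα k hσ0 hσ
  rw [← derivCoeff_apply hα] at h1
  calc ‖derivCoeff hα k f‖ * ‖z‖ ^ k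
      ≤ ((1 + (1 - σ ^ 2) ^ (-α)) / σ ^ k * ‖f‖) * s ^ k := by
        gcongr
        exact (norm_nonneg _).trans h1
    _ = _ := by rw [div_pow]; ring

/-- Dilations `f' ↦ f'(r ·)` are approximated by operators of finite rank. -/
theorem exists_compact_approx_dilation (hα : 0 < α) {r ε : ℝ} (hr0 : 0 < r) (hr1 : r < 1)
    (hε : 0 < ε) : ∃ Q : Zygmund α →L[ℂ] Zygmund α, IsCompactOperator Q ∧
      ∀ (f : Zygmund α), ∀ z ∈ ball (0 : ℂ) 1,
        ‖deriv (f - Q f : Zygmund α) z - (deriv f z - deriv f (r * z))‖ ≤ ε * ‖f‖ ∧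
        ‖deriv (deriv (f - Q f : Zygmund α)) z -
          (deriv (deriv f) z - r * deriv (deriv f) (r * z))‖ ≤ ε * ‖f‖ := by
  -- Radii `r < s < σ < 1`: Taylor coefficients are estimated on radius `σ`, the remainder on radius
  -- `s`, and the gap `s - r` leaves room for a Cauchy estimate of its derivative at `r z`.
  obtain ⟨s, hrs, hs1⟩ := exists_between hr1
  obtain ⟨σ, hsσ, hσ1⟩ := exists_between hs1
  have hs0 : 0 < s := hr0.trans hrs
  have hσ0 : 0 < σ := hs0.trans hsσ
  set M := 1 + (1 - σ ^ 2) ^ (-α) with hM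
  have hMpos : 0 < M := by
    have : 0 ≤ (1 - σ ^ 2) ^ (-α) := Real.rpow_nonneg (by nlinarith) _
    linarith
  have hq1 : s / σ < 1 := (div_lt_one hσ0).2 hsσ
  have hq0 : 0 < s / σ := by positivity
  have hlim : Tendsto (fun N : ℕ => M * (s / σ) ^ N / (1 - s / σ)) atTop (nhds 0) := by
    have := ((tendsto_pow_atTop_nhds_zero_of_lt_one hq0.le hq1).const_mul M).div_const (1 - s / σ)
    simpa using this
  have hδ : 0 < min ε (ε * (s - r)) := lt_min hε (mul_pos hε (by linarith))
  obtain ⟨N, hN⟩ := (hlim.eventually (ge_mem_nhds hδ)).exists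
  have hNε : M * (s / σ) ^ N / (1 - s / σ) ≤ ε := hN.trans (min_le_left _ _)
  have hNε' : M * (s / σ) ^ N / (1 - s / σ) ≤ ε * (s - r) := hN.trans (min_le_right _ _)
  choose e _ he using fun k : ℕ =>
    exists_deriv_eq hα (F := fun z : ℂ => z ^ k) (differentiable_id.pow k)
  -- On the disk, `(Q f)'(z)` is the Taylor polynomial of `f'` of length `N` evaluated at `r z`.
  let Q : Zygmund α →L[ℂ] Zygmund α :=
    ∑ k ∈ Finset.range N, (derivCoeff hα k).smulRight ((r : ℂ) ^ k • e k)
  have hQ : IsCompactOperator Q := by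
    refine Submodule.sum_mem
      (compactOperator (RingHom.id ℂ) (Zygmund α) (Zygmund α)) (fun k _ => ?_)
    exact (isCompactOperator_of_locallyCompactSpace_dom (derivCoeff hα k)).clm_comp
      (ContinuousLinearMap.toSpanSingleton ℂ ((r : ℂ) ^ k • e k))
  have hrmem : ∀ z ∈ ball (0 : ℂ) 1, ‖(r : ℂ) * z‖ < r := fun z hz => by
    rw [norm_mul, Complex.norm_real, Real.norm_of_nonneg hr0.le]
    have := mem_ball_zero_iff.1 hz
    nlinarith
  refine ⟨Q, hQ, fun f => ?_⟩
  set R : ℂ → ℂ := fun x => deriv f x - ∑ k ∈ Finset.range N, derivCoeff hα k f * x ^ k with hR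
  have hRs : ∀ x : ℂ, ‖x‖ ≤ s → ‖R x‖ ≤ M * (s / σ) ^ N / (1 - s / σ) * ‖f‖ := fun x hx => by
    refine (f.norm_deriv_sub_sum_le hα hs0 hsσ hσ1 hx N).trans_eq ?_
    rw [hM]; ring
  have hRd : DifferentiableOn ℂ R (ball 0 1) :=
    (f.differentiableOn.deriv isOpen_ball).sub (by fun_prop)
  have hder : ∀ z ∈ ball (0 : ℂ) 1, deriv (f - Q f : Zygmund α) z =
      (deriv f z - deriv f (r * z)) + R (r * z) := fun z hz => by
    have h1 : deriv (Q f) z = ∑ k ∈ Finset.range N, derivCoeff hα k f * (r * z) ^ k := by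
      change derivEval α hz (Q f) = _
      simp only [Q, sum_apply, map_sum, ContinuousLinearMap.smulRight_apply,
        map_smul]
      refine Finset.sum_congr rfl fun k _ => ?_
      rw [show derivEval α hz (e k) = z ^ k from (he k z hz).1, mul_pow]
      simp
    rw [deriv_sub _ _ hz, h1, hR]
    ring
  intro z hz
  have hrz : (r : ℂ) * z ∈ ball (0 : ℂ) 1 := mem_ball_zero_iff.2 ((hrmem z hz).trans hr1)
  refine ⟨?_, ?_⟩
  · rw [hder z hz, add_sub_cancel_left]
    exact (hRs _ ((hrmem z hz).le.trans hrs.le)).trans (by gcongr)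
  · have hmul : HasDerivAt (fun z : ℂ => (r : ℂ) * z) r z := by
      simpa using (hasDerivAt_id z).const_mul (r : ℂ)
    have hR1 : HasDerivAt (fun z => R (r * z)) (deriv R (r * z) * r) z :=
      (hRd.differentiableAt (isOpen_ball.mem_nhds hrz)).hasDerivAt.comp z hmul
    have hf1 : HasDerivAt (fun z => deriv f (r * z)) (deriv (deriv f) (r * z) * r) z :=
      (f.differentiableAt_deriv hrz).hasDerivAt.comp z hmul
    have hev : deriv (f - Q f : Zygmund α) =ᶠ[nhds z]
        fun z => (deriv f z - deriv f (r * z)) + R (r * z) :=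
      Filter.eventuallyEq_of_mem (isOpen_ball.mem_nhds hz) hder
    rw [hev.deriv_eq, (((f.differentiableAt_deriv hz).hasDerivAt.fun_sub hf1).fun_add hR1).deriv]
    have hsub : closedBall ((r : ℂ) * z) (s - r) ⊆ closedBall 0 s := fun x hx => by
      rw [mem_closedBall_iff_norm] at hx
      rw [mem_closedBall_zero_iff]
      have := norm_add_le (x - r * z) (r * z)
      rw [sub_add_cancel] at this
      linarith [hrmem z hz]
    have hC := Complex.norm_deriv_le_of_forall_mem_sphere_norm_le (c := (r : ℂ) * z) (f := R)
      (R := s - r) (C := ε * (s - r) * ‖f‖) (by linarith)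
      ((hRd.mono (hsub.trans (closedBall_subset_ball hs1))).diffContOnCl_ball subset_rfl)
      (fun x hx => (hRs x (mem_closedBall_zero_iff.1 (hsub (sphere_subset_closedBall hx)))).trans
        (by gcongr))
    have hpos : 0 < s - r := by linarith
    have hC' : ‖deriv R (r * z)‖ ≤ ε * ‖f‖ := hC.trans_eq (by field_simp)
    calc _ = ‖deriv R (r * z) * r‖ := by congr 1; ring
      _ = ‖deriv R (r * z)‖ * r := by
          rw [norm_mul, Complex.norm_real, Real.norm_of_nonneg hr0.le]
      _ ≤ ‖deriv R (r * z)‖ * 1 := by gcongr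
      _ ≤ ε * ‖f‖ := by rw [mul_one]; exact hC'

/-- Three properties of `I - Q` are needed together: a seminorm bound independent of `r`, growth of
the first derivative governed by an increment of `ψ`, and smallness on `|z| ≤ ρ`. The last holds
because `f'` is Lipschitz on compact disks, so `f'(z) - f'(r z)` is small there once `r` is near
`1`. -/
theorem exists_compact_approx (hα : 0 < α) {ψ : ℝ → ℝ}
    (hψ : ∀ t, 0 ≤ t → t < 1 → HasDerivAt ψ ((1 - t) ^ (-α)) t) {ρ r₀ ε : ℝ} (hρ0 : 0 ≤ ρ)
    (hρ : ρ < 1) (hr₀ : r₀ < 1) (hε : 0 < ε) :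
    ∃ r : ℝ, r₀ < r ∧ 0 < r ∧ r < 1 ∧ ∃ Q : Zygmund α →L[ℂ] Zygmund α, IsCompactOperator Q ∧
      ∀ (f : Zygmund α), ∀ z ∈ ball (0 : ℂ) 1,
        (1 - ‖z‖ ^ 2) ^ α * ‖deriv (deriv (f - Q f : Zygmund α)) z‖ ≤ 3 * ‖f‖ ∧
        ‖deriv (f - Q f : Zygmund α) z‖ ≤ ‖f‖ * (ε + (ψ ‖z‖ - ψ (r * ‖z‖))) ∧
        (‖z‖ ≤ ρ → ‖deriv (f - Q f : Zygmund α) z‖ ≤ ε * ‖f‖ ∧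
          ‖deriv (deriv (f - Q f : Zygmund α)) z‖ ≤ ε * ‖f‖) := by
  obtain ⟨ρ₁, hρρ₁, hρ₁⟩ := exists_between hρ
  set L := (1 - ρ₁ ^ 2) ^ (-α) with hL
  have hLpos : 0 < L := Real.rpow_pos_of_pos (by nlinarith) _
  obtain ⟨τ, hτ0, hτ1, hτε, hτε'⟩ : ∃ τ : ℝ, 0 < τ ∧ τ ≤ 1 ∧ τ ≤ ε ∧ τ ≤ ε * (ρ₁ - ρ) :=
    ⟨min 1 (min ε (ε * (ρ₁ - ρ))),
      lt_min one_pos (lt_min hε (mul_pos hε (by linarith))), min_le_left _ _,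
      (min_le_right _ _).trans (min_le_left _ _), (min_le_right _ _).trans (min_le_right _ _)⟩
  -- With `L` the Lipschitz factor of `f'` on `|z| ≤ ρ₁`, this forces `L (1 - r) ≤ τ / 2`; the other
  -- `τ / 2` is the error of `Q`.
  obtain ⟨r, hr, hr1⟩ : ∃ r, max (max r₀ 0) (1 - τ / (2 * L)) < r ∧ r < 1 :=
    exists_between (max_lt (max_lt hr₀ one_pos) (by
      have : 0 < τ / (2 * L) := by positivity
      linarith))
  obtain ⟨⟨hrr₀, hr0⟩, hrτ⟩ : (r₀ < r ∧ 0 < r) ∧ 1 - τ / (2 * L) < r := by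
    simpa only [max_lt_iff] using hr
  have hLr : L * (1 - r) ≤ τ / 2 := by
    have h1 : 1 - r ≤ τ / (2 * L) := by linarith
    calc L * (1 - r) ≤ L * (τ / (2 * L)) := by gcongr
      _ = τ / 2 := by field_simp
  obtain ⟨Q, hQ, hQ'⟩ := exists_compact_approx_dilation hα hr0 hr1 (half_pos hτ0)
  refine ⟨r, hrr₀, hr0, hr1, Q, hQ, fun f => ?_⟩
  have hnf := norm_nonneg f
  have hrz : ∀ z ∈ ball (0 : ℂ) 1, ‖(r : ℂ) * z‖ = r * ‖z‖ := fun z hz => by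
    rw [norm_mul, Complex.norm_real, Real.norm_of_nonneg hr0.le]
  have hin : ∀ z : ℂ, ‖z‖ ≤ ρ₁ → ‖deriv (f - Q f : Zygmund α) z‖ ≤ τ * ‖f‖ := fun z hz => by
    have hz1 : z ∈ ball (0 : ℂ) 1 := mem_ball_zero_iff.2 (hz.trans_lt hρ₁)
    have h1 := (hQ' f z hz1).1
    have h2 := f.norm_deriv_sub_le hα hρ₁ hz (w := r * z) (by
      rw [hrz z hz1]; nlinarith [norm_nonneg z])
    have h3 : ‖z - r * z‖ ≤ 1 - r := by
      rw [show z - r * z = ((1 - r : ℝ) : ℂ) * z by push_cast; ring, norm_mul, Complex.norm_real,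
        Real.norm_of_nonneg (by linarith)]
      nlinarith [norm_nonneg z]
    have h4 : ‖f‖ * L * ‖z - r * z‖ ≤ ‖f‖ * (τ / 2) := by
      calc ‖f‖ * L * ‖z - r * z‖ ≤ ‖f‖ * L * (1 - r) := by gcongr
        _ = ‖f‖ * (L * (1 - r)) := by ring
        _ ≤ _ := by gcongr
    have h5 := norm_le_norm_add_norm_sub' (deriv (f - Q f : Zygmund α) z)
      (deriv f z - deriv f (r * z))
    linarith
  intro z hz
  have hz1 := mem_ball_zero_iff.1 hz
  have hrz1 : (r : ℂ) * z ∈ ball (0 : ℂ) 1 := by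
    rw [mem_ball_zero_iff, hrz z hz]; nlinarith [norm_nonneg z]
  refine ⟨?_, ?_, fun hzρ => ⟨?_, ?_⟩⟩
  · have h1 := (hQ' f z hz).2
    have h5 := norm_le_norm_add_norm_sub' (deriv (deriv (f - Q f : Zygmund α)) z)
      (deriv (deriv f) z - r * deriv (deriv f) (r * z))
    have h6 := norm_sub_le (deriv (deriv f) z) (r * deriv (deriv f) (r * z))
    have hw0 : 0 ≤ (1 - ‖z‖ ^ 2) ^ α := Real.rpow_nonneg (one_sub_norm_sq_pos hz).le _
    have hw1 : (1 - ‖z‖ ^ 2) ^ α ≤ 1 :=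
      Real.rpow_le_one (one_sub_norm_sq_pos hz).le (by nlinarith [norm_nonneg z]) hα.le
    have h7 := f.weight_mul_deriv2_le hz
    -- Dilation does not increase the seminorm, since the weight decreases in `|z|`.
    have h8 : (1 - ‖z‖ ^ 2) ^ α * ‖r * deriv (deriv f) (r * z)‖ ≤ ‖f‖ := by
      refine le_trans ?_ (f.weight_mul_deriv2_le hrz1)
      have h10 : r * ‖z‖ ≤ ‖z‖ := by nlinarith [norm_nonneg z]
      have h11 : 0 ≤ r * ‖z‖ := by positivity
      refine mul_le_mul (Real.rpow_le_rpow (one_sub_norm_sq_pos hz).le ?_ hα.le) ?_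
        (norm_nonneg _) (Real.rpow_nonneg (one_sub_norm_sq_pos hrz1).le _)
      · rw [hrz z hz]
        gcongr
      · rw [norm_mul, Complex.norm_real, Real.norm_of_nonneg hr0.le]
        exact mul_le_of_le_one_left (norm_nonneg _) hr1.le
    have h9 : (1 - ‖z‖ ^ 2) ^ α * (τ / 2 * ‖f‖) ≤ 1 * (1 * ‖f‖) := by
      gcongr; linarith
    calc (1 - ‖z‖ ^ 2) ^ α * ‖deriv (deriv (f - Q f : Zygmund α)) z‖
        ≤ (1 - ‖z‖ ^ 2) ^ α * (‖deriv (deriv f) z‖ + ‖r * deriv (deriv f) (r * z)‖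
          + τ / 2 * ‖f‖) := by gcongr; linarith
      _ ≤ 3 * ‖f‖ := by rw [mul_add, mul_add]; linarith
  · have h1 := (hQ' f z hz).1
    have h2 := f.norm_deriv_sub_deriv_le hα hψ hz hr0.le hr1.le
    have h5 := norm_le_norm_add_norm_sub' (deriv (f - Q f : Zygmund α) z)
      (deriv f z - deriv f (r * z))
    have h6 : τ / 2 * ‖f‖ ≤ ε * ‖f‖ := by gcongr; linarith
    linarith
  · exact (hin z (by linarith)).trans (by gcongr)
  -- The second derivative is handled by Cauchy's estimate on a disk of radius `ρ₁ - ρ`; this is why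
  -- `τ` was taken below `ε (ρ₁ - ρ)`.
  · have hpos : 0 < ρ₁ - ρ := by linarith
    have hsub : closedBall z (ρ₁ - ρ) ⊆ closedBall 0 ρ₁ := fun x hx => by
      rw [mem_closedBall_iff_norm] at hx
      rw [mem_closedBall_zero_iff]
      have := norm_add_le (x - z) z
      rw [sub_add_cancel] at this
      linarith
    refine (Complex.norm_deriv_le_of_forall_mem_sphere_norm_le (C := ε * (ρ₁ - ρ) * ‖f‖) hpos
      ((((f - Q f : Zygmund α).differentiableOn.deriv isOpen_ball).mono
        (hsub.trans (closedBall_subset_ball hρ₁))).diffContOnCl_ball subset_rfl)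
      (fun x hx => (hin x (mem_closedBall_zero_iff.1
        (hsub (sphere_subset_closedBall hx)))).trans (by gcongr))).trans_eq ?_
    field_simp

end Zygmund

/-! ### Upper estimate of the essential norm from boundary behaviour of the symbols. -/

/-- Take `K = -TQ`, so that `(T + K) f = T (f - Q f)`. Where `|φ z|` stays away from `1`, smallness
of `f - Q f` beats the bound `M` on the symbols; elsewhere `hu` and `hw` apply. The total `6A` is
`A` for the derivative at the origin, `3A` for the `gφ'` term and `2A` for the `g'` term. -/
theorem IsVolterraComp.essNorm_le {α β : ℝ} {g φ : ℂ → ℂ} {T : Zygmund α →L[ℂ] Zygmund β}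
    (hT : IsVolterraComp g φ T) (hα : 0 < α) {ψ : ℝ → ℝ}
    (hψ : ∀ t, 0 ≤ t → t < 1 → HasDerivAt ψ ((1 - t) ^ (-α)) t) {A ρ r₀ : ℝ} (hA : 0 < A)
    (hρ : ρ < 1) (hr₀ : r₀ < 1)
    (hu : ∀ z ∈ ball (0 : ℂ) 1, ρ < ‖φ z‖ →
      (1 - ‖z‖ ^ 2) ^ β * ‖g z * deriv φ z‖ ≤ A * (1 - ‖φ z‖ ^ 2) ^ α)
    (hw : ∀ r, r₀ < r → 0 < r → r < 1 → ∀ z ∈ ball (0 : ℂ) 1, ρ < ‖φ z‖ →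
      (1 - ‖z‖ ^ 2) ^ β * ‖deriv g z‖ * (ψ ‖φ z‖ - ψ (r * ‖φ z‖)) ≤ A) :
    essNorm T ≤ ENNReal.ofReal (6 * A) := by
  obtain ⟨M, hM, hMb⟩ := hT.exists_bound hα
  have h0 : (0 : ℂ) ∈ ball (0 : ℂ) 1 := by simp
  obtain ⟨ε, hε, hεM, hεg⟩ : ∃ ε : ℝ, 0 < ε ∧ ε * (2 * M) ≤ A ∧ ε * ‖g 0‖ ≤ A := by
    have hpos : 0 < 2 * M + ‖g 0‖ := by positivity
    have heq : A / (2 * M + ‖g 0‖) * (2 * M + ‖g 0‖) = A := div_mul_cancel₀ _ hpos.ne'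
    have hq : 0 < A / (2 * M + ‖g 0‖) := by positivity
    refine ⟨A / (2 * M + ‖g 0‖), hq, ?_, ?_⟩
    · nlinarith [norm_nonneg (g 0)]
    · nlinarith
  -- The radius includes `‖φ 0‖` so that `(T (f - Q f))'(0)` is small as well.
  obtain ⟨r, hr, hr0, hr1, Q, hQ, hQ'⟩ := Zygmund.exists_compact_approx hα hψ
    (ρ := max ρ ‖φ 0‖) (le_max_of_le_right (norm_nonneg _))
    (max_lt hρ (mem_ball_zero_iff.1 (hT.mapsTo h0))) hr₀ hε
  refine (iInf₂_le (-(T ∘L Q)) (hQ.clm_comp T).neg).trans ?_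
  rw [← ofReal_norm]
  refine ENNReal.ofReal_le_ofReal (ContinuousLinearMap.opNorm_le_bound _ (by positivity) fun f => ?_)
  have hTf : (T + -(T ∘L Q)) f = T (f - Q f) := by
    rw [map_sub, sub_eq_add_neg]; rfl
  have hnf := norm_nonneg f
  rw [hTf]
  have := hT.norm_apply_le (f - Q f) (c := 5 * A * ‖f‖) (d := A * ‖f‖) (by positivity) ?_ ?_
  · linarith
  · have := ((hQ' f (φ 0) (hT.mapsTo h0)).2.2 (le_max_right _ _)).1
    calc _ ≤ ε * ‖f‖ * ‖g 0‖ := by gcongr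
      _ = ε * ‖g 0‖ * ‖f‖ := by ring
      _ ≤ _ := by gcongr
  · intro z hz
    have hφz := hT.mapsTo hz
    obtain ⟨ha, hb, hc⟩ := hQ' f (φ z) hφz
    obtain ⟨hMu, hMw⟩ := hMb z hz
    have hw0 : 0 ≤ (1 - ‖z‖ ^ 2) ^ β := Real.rpow_nonneg (one_sub_norm_sq_pos hz).le _
    set m := (1 - ‖z‖ ^ 2) ^ β with hm
    set h := f - Q f with hh
    have hsplit : m * ‖deriv (deriv h) (φ z) * (g z * deriv φ z) + deriv h (φ z) * deriv g z‖ ≤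
        m * ‖g z * deriv φ z‖ * ‖deriv (deriv h) (φ z)‖ + m * ‖deriv g z‖ * ‖deriv h (φ z)‖ := by
      calc _ ≤ m * (‖deriv (deriv h) (φ z) * (g z * deriv φ z)‖ + ‖deriv h (φ z) * deriv g z‖) := by
            gcongr; exact norm_add_le _ _
        _ = _ := by rw [norm_mul (deriv (deriv h) (φ z)), norm_mul (deriv h (φ z))]; ring
    refine hsplit.trans ?_
    rcases le_or_gt ‖φ z‖ (max ρ ‖φ 0‖) with hle | hgt
    · obtain ⟨hc1, hc2⟩ := hc hle
      calc _ ≤ M * (ε * ‖f‖) + M * (ε * ‖f‖) := by gcongr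
        _ = ε * (2 * M) * ‖f‖ := by ring
        _ ≤ 5 * A * ‖f‖ := mul_le_mul_of_nonneg_right (by linarith) hnf
    · have hgtρ : ρ < ‖φ z‖ := (le_max_left _ _).trans_lt hgt
      have h1 := hu z hz hgtρ
      have h2 := hw r hr hr0 hr1 z hz hgtρ
      have h3 : m * ‖g z * deriv φ z‖ * ‖deriv (deriv h) (φ z)‖ ≤ A * (3 * ‖f‖) := by
        calc _ ≤ A * (1 - ‖φ z‖ ^ 2) ^ α * ‖deriv (deriv h) (φ z)‖ := by gcongr
          _ = A * ((1 - ‖φ z‖ ^ 2) ^ α * ‖deriv (deriv h) (φ z)‖) := by ring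
          _ ≤ _ := by gcongr
      have h4 : m * ‖deriv g z‖ * ‖deriv h (φ z)‖ ≤ 2 * A * ‖f‖ := by
        calc m * ‖deriv g z‖ * ‖deriv h (φ z)‖
            ≤ m * ‖deriv g z‖ * (‖f‖ * (ε + (ψ ‖φ z‖ - ψ (r * ‖φ z‖)))) := by gcongr
          _ = ‖f‖ * (ε * (m * ‖deriv g z‖)) +
              ‖f‖ * (m * ‖deriv g z‖ * (ψ ‖φ z‖ - ψ (r * ‖φ z‖))) := by ring
          _ ≤ ‖f‖ * (ε * M) + ‖f‖ * A := by gcongr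
          _ ≤ 2 * A * ‖f‖ := by nlinarith
      linarith

/-! ### Compact operators and sequences drifting to the boundary. -/

/-- A compact operator maps to zero every bounded sequence all of whose subsequences have a
further subsequence with bounded partial sums. -/
theorem IsCompactOperator.tendsto_zero_of_bounded_sums {X Y : Type*} [NormedAddCommGroup X]
    [NormedSpace ℂ X] [NormedAddCommGroup Y] [NormedSpace ℂ Y] {K : X →L[ℂ] Y}
    (hK : IsCompactOperator K) {x : ℕ → X} {C : ℝ} (hx : ∀ n, ‖x n‖ ≤ C)
    (hsum : ∀ ψ : ℕ → ℕ, StrictMono ψ → ∃ χ : ℕ → ℕ, StrictMono χ ∧ ∃ B : ℝ, ∀ J : ℕ,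
      ‖∑ j ∈ Finset.range J, x (ψ (χ j))‖ ≤ B) :
    Tendsto (fun n => K (x n)) atTop (nhds 0) := by
  refine tendsto_of_subseq_tendsto fun ns hns => ?_
  obtain ⟨θ, -, hθ⟩ := strictMono_subseq_of_tendsto_atTop hns
  obtain ⟨S, hS, hKS⟩ := IsCompactOperator.image_closedBall_subset_compact
    (f := (K : X →ₗ[ℂ] Y)) hK C
  obtain ⟨y, -, η, hη, hy⟩ := hS.tendsto_subseq (x := fun n => K (x (ns (θ n)))) fun n =>
    hKS ⟨x (ns (θ n)), mem_closedBall_zero_iff.2 (hx _), rfl⟩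
  refine ⟨θ ∘ η, ?_⟩
  -- If the images converge to `y`, so do their Cesàro means; but these are `K` of bounded sums
  -- divided by `n`, hence `y = 0`. No weak convergence or duality is needed.
  obtain ⟨χ, hχ, B, hB⟩ := hsum _ (hθ.comp hη)
  have hces := (hy.comp hχ.tendsto_atTop).cesaro_smul
  have hzero : Tendsto (fun n : ℕ => (n : ℝ)⁻¹ • ∑ i ∈ Finset.range n,
      (((fun n => K (x (ns (θ n)))) ∘ η) ∘ χ) i) atTop (nhds 0) := by
    refine squeeze_zero_norm (a := fun n : ℕ => (n : ℝ)⁻¹ * (‖K‖ * B)) (fun n => ?_) ?_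
    · rw [norm_smul, Real.norm_of_nonneg (by positivity)]
      gcongr
      have : ∑ i ∈ Finset.range n, (((fun n => K (x (ns (θ n)))) ∘ η) ∘ χ) i =
          K (∑ j ∈ Finset.range n, x (((ns ∘ θ) ∘ η) (χ j))) := by
        rw [map_sum]; rfl
      rw [this]
      exact K.le_opNorm_of_le (hB n)
    · simpa using (tendsto_inv_atTop_nhds_zero_nat (𝕜 := ℝ)).mul_const (‖K‖ * B)
  have hy0 : y = 0 := tendsto_nhds_unique hces hzero
  rw [hy0] at hy
  exact hy

/-- Gliding hump: a bounded sequence of functions that is asymptotically disjoint has a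
subsequence with bounded partial sums. -/
theorem exists_strictMono_sum_le {ι : Type*} {p : ℕ → ι → ℝ} {C : ℝ} (hp0 : ∀ n z, 0 ≤ p n z)
    (hpC : ∀ n z, p n z ≤ C)
    (hmin : ∀ m, ∀ ε > 0, ∀ᶠ n in atTop, ∀ z, min (p m z) (p n z) ≤ ε) :
    ∃ χ : ℕ → ℕ, StrictMono χ ∧ ∀ J z, ∑ j ∈ Finset.range J, p (χ j) z ≤ C + 3 := by
  -- The first component of each pair is a counter, so the tolerance for overlap with all earlier
  -- humps shrinks geometrically.
  obtain ⟨f, -, hf⟩ := exists_seq_of_forall_finset_exists (α := ℕ × ℕ) (fun _ => True)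
    (fun a b => a.1 < b.1 ∧ a.2 < b.2 ∧ ∀ z, min (p a.2 z) (p b.2 z) ≤ (1 / 2 : ℝ) ^ b.1)
    (fun s _ => by
      have h1 : ∀ᶠ n in atTop, ∀ a ∈ s, a.2 < n ∧
          ∀ z, min (p a.2 z) (p n z) ≤ (1 / 2 : ℝ) ^ (s.sup Prod.fst + 1) := by
        rw [Filter.eventually_all_finset]
        exact fun a _ => (eventually_gt_atTop a.2).and (hmin a.2 _ (by positivity))
      obtain ⟨n, hn⟩ := h1.exists
      exact ⟨(s.sup Prod.fst + 1, n), trivial, fun a ha =>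
        ⟨Nat.lt_succ_of_le (Finset.le_sup (f := Prod.fst) ha), hn a ha⟩⟩)
  have hk : StrictMono fun j => (f j).1 := fun i j hij => (hf i j hij).1
  have hpow : ∀ j, (1 / 2 : ℝ) ^ (f j).1 ≤ (1 / 2 : ℝ) ^ j := fun j =>
    pow_le_pow_of_le_one (by norm_num) (by norm_num) (hk.id_le j)
  refine ⟨fun j => (f j).2, fun i j hij => (hf i j hij).2.1, fun J z => ?_⟩
  -- Either the new term is at most `2^(-J)`, or all `J` earlier ones are; in the second case they
  -- add up to at most `J 2^(-J) ≤ 1` and the new term costs at most `C`.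
  have key : ∀ J, ∑ j ∈ Finset.range J, p (f j).2 z ≤
      C + 1 + ∑ j ∈ Finset.range J, (1 / 2 : ℝ) ^ j := by
    intro J
    have hC0 : 0 ≤ C := (hp0 0 z).trans (hpC 0 z)
    induction J with
    | zero => simp; linarith
    | succ J ih =>
      rw [Finset.sum_range_succ, Finset.sum_range_succ]
      rcases le_or_gt (p (f J).2 z) ((1 / 2 : ℝ) ^ J) with h | h
      · linarith
      · have h1 : ∑ j ∈ Finset.range J, p (f j).2 z ≤ ∑ j ∈ Finset.range J, (1 / 2 : ℝ) ^ J := by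
          refine Finset.sum_le_sum fun j hj => ?_
          have h2 := ((hf j J (Finset.mem_range.1 hj)).2.2 z).trans (hpow J)
          rcases min_le_iff.1 h2 with h3 | h3
          · exact h3
          · exact absurd h3 (not_le.2 h)
        have h4 : ∑ j ∈ Finset.range J, (1 / 2 : ℝ) ^ J ≤ 1 := by
          rw [Finset.sum_const, Finset.card_range, nsmul_eq_mul, one_div, inv_pow,
            ← div_eq_mul_inv, div_le_one (by positivity)]
          exact_mod_cast J.lt_two_pow_self.le
        have h5 : 0 ≤ ∑ j ∈ Finset.range J, (1 / 2 : ℝ) ^ j :=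
          Finset.sum_nonneg fun _ _ => by positivity
        have h6 : (0 : ℝ) ≤ (1 / 2) ^ J := by positivity
        linarith [hpC (f J).2 z]
  have h2 : ∑ j ∈ Finset.range J, (1 / 2 : ℝ) ^ j ≤ 2 :=
    ((summable_geometric_two).sum_le_tsum _ fun _ _ => by positivity).trans_eq tsum_geometric_two
  linarith [key J]

/-- Entire functions `F n` vanishing at `0`, bounded in the `α`-Bloch seminorm, whose derivatives
tend to zero locally uniformly on the disk. -/
structure IsTestSeq (α B : ℝ) (F : ℕ → ℂ → ℂ) : Prop where
  differentiable : ∀ n, Differentiable ℂ (F n)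
  apply_zero : ∀ n, F n 0 = 0
  weight_mul_le : ∀ n, ∀ z ∈ ball (0 : ℂ) 1, (1 - ‖z‖ ^ 2) ^ α * ‖deriv (F n) z‖ ≤ B
  eventually_le : ∀ ρ < 1, ∀ ε > 0, ∀ᶠ n in atTop, ∀ z : ℂ, ‖z‖ ≤ ρ → ‖deriv (F n) z‖ ≤ ε

namespace IsTestSeq

variable {α B : ℝ} {F : ℕ → ℂ → ℂ}

theorem nonneg (hF : IsTestSeq α B F) : 0 ≤ B := by
  have := hF.weight_mul_le 0 0 (by simp)
  refine le_trans ?_ this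
  simp

/-- For fixed `m` the derivative of an entire function is bounded on the closed disk, while the
weight vanishes at the boundary. -/
theorem exists_small_near_boundary (hα : 0 < α) (hF : IsTestSeq α B F) (m : ℕ) {ε : ℝ}
    (hε : 0 < ε) : ∃ ρ < 1, ∀ z ∈ ball (0 : ℂ) 1, ρ < ‖z‖ →
      (1 - ‖z‖ ^ 2) ^ α * ‖deriv (F m) z‖ ≤ ε := by
  obtain ⟨D, hD⟩ := (isCompact_closedBall (0 : ℂ) 1).exists_bound_of_continuousOn
    ((hF.differentiable m).contDiff (n := 1)).continuous_deriv_one.continuousOn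
  have hD0 : 0 ≤ D := (norm_nonneg _).trans (hD 0 (by simp))
  have hcont : Continuous fun t : ℝ => (1 - t ^ 2) ^ α * D :=
    ((by fun_prop : Continuous fun t : ℝ => 1 - t ^ 2).rpow_const fun _ => Or.inr hα.le).mul_const D
  have h1 : ∀ᶠ t in nhds (1 : ℝ), (1 - t ^ 2) ^ α * D < ε := by
    refine hcont.continuousAt.eventually (gt_mem_nhds ?_)
    simpa [Real.zero_rpow hα.ne'] using hε
  obtain ⟨δ, hδ, h2⟩ := Metric.eventually_nhds_iff.1 h1
  refine ⟨1 - δ, by linarith, fun z hz hzδ => ?_⟩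
  have hz1 := mem_ball_zero_iff.1 hz
  refine le_trans ?_ (h2 (y := ‖z‖) (by rw [Real.dist_eq, abs_lt]; constructor <;> linarith)).le
  have := Real.rpow_nonneg (one_sub_norm_sq_pos hz).le α
  gcongr
  exact hD z (ball_subset_closedBall hz)

theorem eventually_min_le (hα : 0 < α) (hF : IsTestSeq α B F) (m : ℕ) {ε : ℝ} (hε : 0 < ε) :
    ∀ᶠ n in atTop, ∀ z : ball (0 : ℂ) 1, min ((1 - ‖(z : ℂ)‖ ^ 2) ^ α * ‖deriv (F m) z‖)
      ((1 - ‖(z : ℂ)‖ ^ 2) ^ α * ‖deriv (F n) z‖) ≤ ε := by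
  obtain ⟨ρ, hρ, h⟩ := hF.exists_small_near_boundary hα m hε
  filter_upwards [hF.eventually_le ρ hρ ε hε] with n hn z
  rcases le_or_gt ‖(z : ℂ)‖ ρ with hz | hz
  · refine min_le_of_right_le ((mul_le_of_le_one_left (norm_nonneg _) ?_).trans (hn z hz))
    exact Real.rpow_le_one (one_sub_norm_sq_pos z.2).le (by nlinarith [norm_nonneg (z : ℂ)]) hα.le
  · exact min_le_of_left_le (h z z.2 hz)

theorem comp_strictMono (hF : IsTestSeq α B F) {ψ : ℕ → ℕ} (hψ : StrictMono ψ) :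
    IsTestSeq α B fun n => F (ψ n) :=
  ⟨fun _ => hF.differentiable _, fun _ => hF.apply_zero _, fun _ => hF.weight_mul_le _,
    fun ρ hρ ε hε => hψ.tendsto_atTop.eventually (hF.eventually_le ρ hρ ε hε)⟩

theorem exists_bounded_sums (hα : 0 < α) (hF : IsTestSeq α B F) {f : ℕ → Zygmund α}
    (hf0 : ∀ n, f n 0 = 0) (hf : ∀ n, ∀ z ∈ ball (0 : ℂ) 1, deriv (f n) z = F n z ∧
      deriv (deriv (f n)) z = deriv (F n) z) :
    ∃ χ : ℕ → ℕ, StrictMono χ ∧ ∃ C : ℝ, ∀ J : ℕ, ‖∑ j ∈ Finset.range J, f (χ j)‖ ≤ C := by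
  obtain ⟨χ, hχ, hsum⟩ := exists_strictMono_sum_le
    (p := fun n (z : ball (0 : ℂ) 1) => (1 - ‖(z : ℂ)‖ ^ 2) ^ α * ‖deriv (F n) z‖)
    (fun n z => mul_nonneg (Real.rpow_nonneg (one_sub_norm_sq_pos z.2).le _) (norm_nonneg _))
    (fun n z => hF.weight_mul_le n z z.2) (fun m ε hε => hF.eventually_min_le hα m hε)
  have h0 : (0 : ℂ) ∈ ball (0 : ℂ) 1 := by simp
  refine ⟨χ, hχ, B + 3, fun J => ?_⟩
  have key : ∀ J : ℕ, (∑ j ∈ Finset.range J, f (χ j) : Zygmund α) 0 = 0 ∧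
      deriv (∑ j ∈ Finset.range J, f (χ j) : Zygmund α) 0 = 0 ∧ ∀ z ∈ ball (0 : ℂ) 1,
        ‖deriv (deriv (∑ j ∈ Finset.range J, f (χ j) : Zygmund α)) z‖ ≤
          ∑ j ∈ Finset.range J, ‖deriv (F (χ j)) z‖ := by
    intro J
    induction J with
    | zero =>
      have hd : deriv (0 : ℂ → ℂ) = 0 := by funext z; simp
      simp [Zygmund.coe_zero, hd]
    | succ J ih =>
      obtain ⟨ih0, ih1, ih2⟩ := ih
      rw [Finset.sum_range_succ, Zygmund.coe_add]
      refine ⟨by rw [Pi.add_apply, ih0, hf0, zero_add], ?_, fun z hz => ?_⟩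
      · rw [deriv_add_disk (Zygmund.differentiableOn _) (Zygmund.differentiableOn _) h0, ih1,
          (hf _ 0 h0).1, hF.apply_zero, zero_add]
      · rw [deriv2_add_disk (Zygmund.differentiableOn _) (Zygmund.differentiableOn _) hz,
          (hf _ z hz).2, Finset.sum_range_succ]
        exact (norm_add_le _ _).trans (by gcongr; exact ih2 z hz)
  obtain ⟨k0, k1, k2⟩ := key J
  refine (Zygmund.norm_le_of_forall _ (c := B + 3) (by linarith [hF.nonneg]) fun z hz => ?_).trans
    (by rw [k0, k1]; simp)
  have hw := Real.rpow_nonneg (one_sub_norm_sq_pos hz).le α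
  calc _ ≤ (1 - ‖z‖ ^ 2) ^ α * ∑ j ∈ Finset.range J, ‖deriv (F (χ j)) z‖ := by
        gcongr; exact k2 z hz
    _ ≤ B + 3 := by rw [Finset.mul_sum]; exact hsum J ⟨z, hz⟩

end IsTestSeq

/-- Let `f n` have derivative `F n`, and choose a compact `K` with `‖T + K‖ < c`. Since `T f = (T +
K) f - K f` and `K (f n) → 0`, the bound is `B c` plus a final `c`. -/
theorem IsVolterraComp.eventually_testSeq_le {α β : ℝ} {g φ : ℂ → ℂ}
    {T : Zygmund α →L[ℂ] Zygmund β} (hT : IsVolterraComp g φ T) (hα : 0 < α) {B : ℝ}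
    {F : ℕ → ℂ → ℂ} (hF : IsTestSeq α B F) {c : ℝ} (hc : 0 < c)
    (hess : essNorm T < ENNReal.ofReal c) :
    ∀ᶠ n in atTop, ∀ z ∈ ball (0 : ℂ) 1, (1 - ‖z‖ ^ 2) ^ β *
      ‖deriv (F n) (φ z) * (g z * deriv φ z) + F n (φ z) * deriv g z‖ ≤ (B + 1) * c := by
  obtain ⟨K, hK, hTK⟩ : ∃ K : Zygmund α →L[ℂ] Zygmund β, IsCompactOperator K ∧ ‖T + K‖ < c := by
    simp only [essNorm, iInf_lt_iff] at hess
    obtain ⟨K, hK, h⟩ := hess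
    refine ⟨K, hK, ?_⟩
    rwa [← ofReal_norm, ENNReal.ofReal_lt_ofReal_iff hc] at h
  have hB := hF.nonneg
  choose f hf0 hf using fun n => Zygmund.exists_deriv_eq hα (hF.differentiable n)
  have hfB : ∀ n, ‖f n‖ ≤ B := fun n => by
    refine ((f n).norm_le_of_forall hB fun z hz => ?_).trans_eq (c := B) ?_
    · rw [(hf n z hz).2]; exact hF.weight_mul_le n z hz
    · rw [hf0, (hf n 0 (by simp)).1, hF.apply_zero]; simp
  have hKf : Tendsto (fun n => K (f n)) atTop (nhds 0) :=
    hK.tendsto_zero_of_bounded_sums hfB fun ψ hψ =>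
      (hF.comp_strictMono hψ).exists_bounded_sums hα (fun n => hf0 _) (fun n => hf _)
  have hKc : ∀ᶠ n in atTop, ‖K (f n)‖ < c :=
    (tendsto_zero_iff_norm_tendsto_zero.1 hKf).eventually (gt_mem_nhds hc)
  filter_upwards [hKc] with n hn z hz
  have h1 := hT.weight_mul_le (f n) hz
  rw [(hf n _ (hT.mapsTo hz)).1, (hf n _ (hT.mapsTo hz)).2] at h1
  have h2 : ‖T (f n)‖ ≤ ‖(T + K) (f n)‖ + ‖K (f n)‖ := by
    have : T (f n) = (T + K) (f n) - K (f n) := by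
      rw [add_apply, add_sub_cancel_right]
    rw [this]; exact norm_sub_le _ _
  have h3 : ‖(T + K) (f n)‖ ≤ c * B := (T + K).le_of_opNorm_le_of_le hTK.le (hfB n)
  linarith

/-! ### Test sequences: monomials and squared logarithms. -/

theorem rpow_le_rpow_self_mul_exp {α y : ℝ} (hα : 0 < α) (hy : 0 ≤ y) :
    y ^ α ≤ α ^ α * Real.exp y := by
  have h1 : y / α ≤ Real.exp (y / α) := by linarith [Real.add_one_le_exp (y / α)]
  have h2 := Real.rpow_le_rpow (by positivity) h1 hα.le
  rwa [Real.div_rpow hy hα.le, ← Real.exp_mul, div_mul_cancel₀ _ hα.ne',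
    div_le_iff₀ (Real.rpow_pos_of_pos hα _), mul_comm] at h2

/-- Put `y = (n + 1)(1 - x)`: then `x^n ≤ e · e^(-y)`, and `y^α e^(-y) ≤ α^α`. The factor `2^α`
comes from `1 - x² ≤ 2 (1 - x)`. -/
theorem one_sub_sq_rpow_mul_pow_le {α x : ℝ} (hα : 0 < α) (hx0 : 0 ≤ x) (hx1 : x < 1) (n : ℕ) :
    (1 - x ^ 2) ^ α * (((n : ℝ) + 1) ^ α * x ^ n) ≤ 2 ^ α * (α ^ α * Real.exp 1) := by
  have h1x : 0 ≤ 1 - x := by linarith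
  have h1 : (1 - x ^ 2) ^ α ≤ 2 ^ α * (1 - x) ^ α := by
    rw [← Real.mul_rpow (by norm_num) h1x]
    exact Real.rpow_le_rpow (by nlinarith) (by nlinarith) hα.le
  have h2 : x ^ n ≤ Real.exp 1 * Real.exp (-((n + 1) * (1 - x))) := by
    have h3 : x ≤ Real.exp (x - 1) := by linarith [Real.add_one_le_exp (x - 1)]
    calc x ^ n ≤ Real.exp (x - 1) ^ n := by gcongr
      _ = Real.exp (n * (x - 1)) := (Real.exp_nat_mul _ _).symm
      _ ≤ Real.exp (1 + -((n + 1) * (1 - x))) := Real.exp_le_exp.2 (by linarith)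
      _ = _ := Real.exp_add _ _
  have hy : 0 ≤ ((n : ℝ) + 1) * (1 - x) := by positivity
  have h4 := rpow_le_rpow_self_mul_exp hα hy
  calc (1 - x ^ 2) ^ α * (((n : ℝ) + 1) ^ α * x ^ n)
      ≤ (2 ^ α * (1 - x) ^ α) * (((n : ℝ) + 1) ^ α *
          (Real.exp 1 * Real.exp (-((n + 1) * (1 - x))))) := by gcongr
    _ = 2 ^ α * ((((n : ℝ) + 1) * (1 - x)) ^ α *
          (Real.exp 1 * Real.exp (-((n + 1) * (1 - x))))) := by
        rw [Real.mul_rpow (by positivity) h1x]; ring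
    _ ≤ 2 ^ α * ((α ^ α * Real.exp ((n + 1) * (1 - x))) *
          (Real.exp 1 * Real.exp (-((n + 1) * (1 - x))))) := by gcongr
    _ = 2 ^ α * (α ^ α * Real.exp 1) := by
        rw [Real.exp_neg]; field_simp

theorem tendsto_rpow_mul_pow_zero (α : ℝ) {ρ : ℝ} (hρ0 : 0 < ρ) (hρ : ρ < 1) :
    Tendsto (fun n : ℕ => ((n : ℝ) + 1) ^ α * ρ ^ n) atTop (nhds 0) := by
  obtain ⟨k, hk⟩ := exists_nat_ge α
  have h1 := ((tendsto_pow_const_mul_const_pow_of_lt_one k hρ0.le hρ).comp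
    (tendsto_add_atTop_nat 1)).mul_const ρ⁻¹
  rw [zero_mul] at h1
  refine squeeze_zero (fun n => by positivity) (fun n => ?_) h1
  have h2 : ((n : ℝ) + 1) ^ α ≤ ((n : ℝ) + 1) ^ k := by
    rw [← Real.rpow_natCast]
    exact Real.rpow_le_rpow_of_exponent_le (by linarith [n.cast_nonneg (α := ℝ)]) hk
  simp only [Function.comp_apply, Nat.cast_add, Nat.cast_one]
  rw [pow_succ, ← mul_assoc, mul_assoc _ ρ, mul_inv_cancel₀ hρ0.ne', mul_one]
  gcongr

theorem deriv_rpow_mul_monomial (α : ℝ) (n : ℕ) (z : ℂ) :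
    deriv (fun z : ℂ => ((((n : ℝ) + 1) ^ (α - 1) : ℝ) : ℂ) * z ^ (n + 1)) z =
      ((((n : ℝ) + 1) ^ α : ℝ) : ℂ) * z ^ n := by
  rw [((hasDerivAt_pow (n + 1) z).const_mul _).deriv,
    show ((n : ℝ) + 1) ^ α = ((n : ℝ) + 1) ^ (α - 1) * (n + 1) by
      rw [← Real.rpow_add_one (by positivity), sub_add_cancel]]
  push_cast
  ring

theorem isTestSeq_monomial {α : ℝ} (hα : 0 < α) :
    IsTestSeq α (2 ^ α * (α ^ α * Real.exp 1))
      fun n z => ((((n : ℝ) + 1) ^ (α - 1) : ℝ) : ℂ) * z ^ (n + 1) := by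
  have hnorm : ∀ (n : ℕ) (z : ℂ), ‖deriv (fun z : ℂ =>
      ((((n : ℝ) + 1) ^ (α - 1) : ℝ) : ℂ) * z ^ (n + 1)) z‖ =
        ((n : ℝ) + 1) ^ α * ‖z‖ ^ n := fun n z => by
    rw [deriv_rpow_mul_monomial, norm_mul, norm_pow, Complex.norm_real, Real.norm_of_nonneg (by positivity)]
  refine ⟨fun n => by fun_prop, fun n => by simp, fun n z hz => ?_, fun ρ hρ ε hε => ?_⟩
  · rw [hnorm]
    exact one_sub_sq_rpow_mul_pow_le hα (norm_nonneg z) (mem_ball_zero_iff.1 hz) n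
  · have hlim := tendsto_rpow_mul_pow_zero α (ρ := max ρ (1 / 2)) (by positivity)
      (max_lt hρ (by norm_num))
    filter_upwards [hlim.eventually (ge_mem_nhds hε)] with n hn z hz
    rw [hnorm]
    refine le_trans ?_ hn
    gcongr
    exact hz.trans (le_max_left _ _)

/-- The polynomials `∑_{k < n} z^{k+1} / (k+1)`, truncations of `-log (1 - z)`. -/
noncomputable def logPoly (n : ℕ) (z : ℂ) : ℂ := ∑ k ∈ Finset.range n, z ^ (k + 1) / ((k : ℂ) + 1)

theorem hasDerivAt_logPoly (n : ℕ) (z : ℂ) :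
    HasDerivAt (logPoly n) (∑ k ∈ Finset.range n, z ^ k) z := by
  have : ∀ k ∈ Finset.range n,
      HasDerivAt (fun z : ℂ => z ^ (k + 1) / ((k : ℂ) + 1)) (z ^ k) z := fun k _ => by
    have h := (hasDerivAt_pow (k + 1) z).div_const ((k : ℂ) + 1)
    have hk : (k : ℂ) + 1 ≠ 0 := by exact_mod_cast k.succ_ne_zero
    refine h.congr_deriv ?_
    push_cast
    field_simp
  exact HasDerivAt.fun_sum this

theorem norm_geom_sum_le (n : ℕ) {z : ℂ} (hz : ‖z‖ < 1) :
    ‖∑ k ∈ Finset.range n, z ^ k‖ ≤ (1 - ‖z‖)⁻¹ := by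
  calc _ ≤ ∑ k ∈ Finset.range n, ‖z‖ ^ k := by
        refine (norm_sum_le _ _).trans_eq (Finset.sum_congr rfl fun k _ => norm_pow _ _)
    _ ≤ ∑' k : ℕ, ‖z‖ ^ k := (summable_geometric_of_lt_one (norm_nonneg z) hz).sum_le_tsum _
        fun _ _ => by positivity
    _ = _ := tsum_geometric_of_lt_one (norm_nonneg z) hz

theorem norm_logPoly_le (n : ℕ) (z : ℂ) :
    ‖logPoly n z‖ ≤ ∑ k ∈ Finset.range n, ‖z‖ ^ (k + 1) / ((k : ℝ) + 1) := by
  refine (norm_sum_le _ _).trans_eq (Finset.sum_congr rfl fun k _ => ?_)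
  rw [norm_div, norm_pow]
  congr 1
  exact_mod_cast Complex.norm_natCast (k + 1)

theorem sum_inv_eq_harmonic (n : ℕ) :
    ∑ k ∈ Finset.range n, 1 / ((k : ℝ) + 1) = ((harmonic n : ℚ) : ℝ) := by
  simp [harmonic]

theorem norm_logPoly_le_one_add_log (n : ℕ) {z : ℂ} (hz : ‖z‖ < 1) :
    ‖logPoly n z‖ ≤ 1 + Real.log n := by
  refine (norm_logPoly_le n z).trans (le_trans ?_ (harmonic_le_one_add_log n))
  rw [← sum_inv_eq_harmonic]
  gcongr
  exact pow_le_one₀ (norm_nonneg z) hz.le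

/-- A crude bound, dropping the denominators, but uniform in `n`; it serves only for local uniform
convergence of the test sequence. -/
theorem norm_logPoly_le_inv (n : ℕ) {z : ℂ} (hz : ‖z‖ < 1) :
    ‖logPoly n z‖ ≤ (1 - ‖z‖)⁻¹ := by
  refine (norm_logPoly_le n z).trans ?_
  calc _ ≤ ∑ k ∈ Finset.range n, ‖z‖ ^ k := by
        gcongr with k _
        rw [div_le_iff₀ (by positivity), pow_succ]
        gcongr
        linarith [k.cast_nonneg (α := ℝ)]
    _ ≤ ∑' k : ℕ, ‖z‖ ^ k := (summable_geometric_of_lt_one (norm_nonneg z) hz).sum_le_tsum _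
        fun _ _ => by positivity
    _ = _ := tsum_geometric_of_lt_one (norm_nonneg z) hz

/-- On the positive axis there is no cancellation; each `x^(k+1)` with `k < n` is at least `x^n`,
and the harmonic sum is at least `log n`. -/
theorem pow_mul_log_le_norm_logPoly (n : ℕ) {x : ℝ} (hx0 : 0 ≤ x) (hx1 : x ≤ 1) :
    x ^ n * Real.log n ≤ ‖logPoly n (x : ℂ)‖ := by
  have h1 : logPoly n (x : ℂ) = ((∑ k ∈ Finset.range n, x ^ (k + 1) / ((k : ℝ) + 1) : ℝ) : ℂ) := by
    simp [logPoly]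
  rw [h1, Complex.norm_real, Real.norm_of_nonneg (Finset.sum_nonneg fun k _ => by positivity)]
  have h2 : Real.log n ≤ ∑ k ∈ Finset.range n, 1 / ((k : ℝ) + 1) := by
    rw [sum_inv_eq_harmonic]
    refine le_trans ?_ (log_add_one_le_harmonic n)
    rcases n.eq_zero_or_pos with rfl | hn
    · simp
    · have : (0 : ℝ) < n := by exact_mod_cast hn
      exact Real.log_le_log this (by push_cast; linarith)
  calc x ^ n * Real.log n ≤ x ^ n * ∑ k ∈ Finset.range n, 1 / ((k : ℝ) + 1) := by gcongr
    _ ≤ _ := by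
      rw [Finset.mul_sum]
      refine Finset.sum_le_sum fun k hk => ?_
      rw [mul_one_div]
      have := pow_le_pow_of_le_one hx0 hx1 (Finset.mem_range.1 hk)
      gcongr

/-- Squaring and dividing by `log n` keeps a lower bound of order `log n` on the favourable ray near
the boundary. The derivative carries the factor `logPoly / log n`, bounded on the disk and tending
to `0` on compact subsets. The rotations `e n` are left free, to be aimed later at chosen points. -/
theorem isTestSeq_log {e : ℕ → ℂ} (he : ∀ n, ‖e n‖ = 1) :
    IsTestSeq 1 12 fun n z => logPoly n (e n * z) ^ 2 / ((Real.log n : ℝ) : ℂ) := by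
  have hder : ∀ (n : ℕ) (z : ℂ), HasDerivAt
      (fun z => logPoly n (e n * z) ^ 2 / ((Real.log n : ℝ) : ℂ))
      (2 * logPoly n (e n * z) * ((∑ k ∈ Finset.range n, (e n * z) ^ k) * e n) /
        ((Real.log n : ℝ) : ℂ)) z := fun n z => by
    have h1 : HasDerivAt (fun z => e n * z) (e n) z := by
      simpa using (hasDerivAt_id z).const_mul (e n)
    have h2 := (((hasDerivAt_logPoly n (e n * z)).comp z h1).fun_pow 2).div_const
      ((Real.log n : ℝ) : ℂ)
    simpa [Function.comp_def] using h2
  have hlog : ∀ n : ℕ, 0 ≤ Real.log n := Real.log_natCast_nonneg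
  have hnorm : ∀ (n : ℕ) (z : ℂ), ‖z‖ < 1 →
      ‖deriv (fun z => logPoly n (e n * z) ^ 2 / ((Real.log n : ℝ) : ℂ)) z‖ ≤
        2 * ‖logPoly n (e n * z)‖ * (1 - ‖z‖)⁻¹ / Real.log n := fun n z hz => by
    have hez : ‖e n * z‖ = ‖z‖ := by rw [norm_mul, he, one_mul]
    have h1 := norm_geom_sum_le n (z := e n * z) (by rwa [hez])
    rw [hez] at h1
    rw [(hder n z).deriv, norm_div, norm_mul, norm_mul, norm_mul (∑ k ∈ _, _), he, mul_one,
      Complex.norm_real, Real.norm_of_nonneg (hlog n), Complex.norm_ofNat]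
    have := hlog n
    gcongr
  refine ⟨fun n z => (hder n z).differentiableAt, fun n => ?_, fun n z hz => ?_,
    fun ρ hρ ε hε => ?_⟩
  · simp [logPoly]
  · have hz1 := mem_ball_zero_iff.1 hz
    have h1z : 0 < 1 - ‖z‖ := by linarith
    have hez : ‖e n * z‖ = ‖z‖ := by rw [norm_mul, he, one_mul]
    have h1 := norm_logPoly_le_one_add_log n (z := e n * z) (by rwa [hez])
    -- For `n ≥ 2` this is `log 2 > 1/2`; for `n ≤ 1` the logarithm is `0` and division by zero
    -- returns `0`.
    have h2 : (1 + Real.log n) / Real.log n ≤ 3 := by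
      rcases le_or_gt n 1 with hn | hn
      · have : Real.log n = 0 := by interval_cases n <;> simp
        rw [this]; simp
      · have h3 : Real.log 2 ≤ Real.log n :=
          Real.log_le_log (by norm_num) (by exact_mod_cast hn)
        have h4 := Real.log_two_gt_d9
        rw [div_le_iff₀ (by linarith)]
        linarith
    have := hlog n
    rw [Real.rpow_one]
    calc _ ≤ (1 - ‖z‖ ^ 2) * (2 * (1 + Real.log n) * (1 - ‖z‖)⁻¹ / Real.log n) := by
          have := (one_sub_norm_sq_pos hz).le
          gcongr
          exact (hnorm n z hz1).trans (by gcongr)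
      _ = 2 * (1 + ‖z‖) * ((1 + Real.log n) / Real.log n) := by
          field_simp
          ring
      _ ≤ 2 * (1 + 1) * 3 := by gcongr
      _ = 12 := by norm_num
  · set σ := max ρ 0 with hσ
    have hσ1 : σ < 1 := max_lt hρ one_pos
    have hlim : Tendsto (fun n : ℕ => 2 * (1 - σ)⁻¹ * (1 - σ)⁻¹ / Real.log n) atTop (nhds 0) :=
      tendsto_const_nhds.div_atTop (Real.tendsto_log_atTop.comp tendsto_natCast_atTop_atTop)
    filter_upwards [hlim.eventually (ge_mem_nhds hε)] with n hn z hz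
    have hzσ : ‖z‖ ≤ σ := hz.trans (le_max_left _ _)
    have hz1 : ‖z‖ < 1 := hzσ.trans_lt hσ1
    have hez : ‖e n * z‖ = ‖z‖ := by rw [norm_mul, he, one_mul]
    have h1 := norm_logPoly_le_inv n (z := e n * z) (by rwa [hez])
    rw [hez] at h1
    have h2 : (1 - ‖z‖)⁻¹ ≤ (1 - σ)⁻¹ := inv_anti₀ (by linarith) (by linarith)
    have h3 : 0 ≤ (1 - ‖z‖)⁻¹ := inv_nonneg.2 (by linarith)
    have := hlog n
    refine ((hnorm n z hz1).trans ?_).trans hn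
    have h4 : ‖logPoly n (e n * z)‖ ≤ (1 - σ)⁻¹ := h1.trans h2
    have h5 := norm_nonneg (logPoly n (e n * z))
    gcongr

/-! ### From limsups along powers to decay near the boundary, and back. -/

theorem ofReal_mul_weightedSup_le_iff {β c d : ℝ} (hc : 0 ≤ c) (hd : 0 ≤ d) {u φ : ℂ → ℂ} {n : ℕ} :
    ENNReal.ofReal d * weightedSup β (fun z => u z * φ z ^ n) ≤ ENNReal.ofReal c ↔
      ∀ z ∈ ball (0 : ℂ) 1, d * ((1 - ‖z‖ ^ 2) ^ β * ‖u z‖ * ‖φ z‖ ^ n) ≤ c := by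
  have h : ENNReal.ofReal d = ‖(d : ℂ)‖ₑ := by
    rw [← ofReal_norm, Complex.norm_real, Real.norm_of_nonneg hd]
  rw [h, ← weightedSup_smul, weightedSup_le_ofReal_iff hc]
  refine forall₂_congr fun z _ => ?_
  rw [norm_mul, norm_mul, norm_pow, Complex.norm_real, Real.norm_of_nonneg hd]
  ring_nf

theorem eventually_of_limsupPow_lt {β c : ℝ} (hc : 0 ≤ c) {d : ℕ → ℝ} (hd : ∀ n, 0 ≤ d n)
    {u φ : ℂ → ℂ} (h : limsupPow β d u φ < ENNReal.ofReal c) :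
    ∀ᶠ n in atTop, ∀ z ∈ ball (0 : ℂ) 1, d n * ((1 - ‖z‖ ^ 2) ^ β * ‖u z‖ * ‖φ z‖ ^ n) ≤ c := by
  filter_upwards [eventually_lt_of_limsup_lt h] with n hn
  exact (ofReal_mul_weightedSup_le_iff hc (hd n)).1 hn.le

theorem limsupPow_le_of_eventually {β c : ℝ} (hc : 0 ≤ c) {d : ℕ → ℝ} (hd : ∀ n, 0 ≤ d n)
    {u φ : ℂ → ℂ} (h : ∀ᶠ n in atTop, ∀ z ∈ ball (0 : ℂ) 1,
      d n * ((1 - ‖z‖ ^ 2) ^ β * ‖u z‖ * ‖φ z‖ ^ n) ≤ c) :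
    limsupPow β d u φ ≤ ENNReal.ofReal c := by
  refine limsup_le_of_le (by isBoundedDefault) ?_
  filter_upwards [h] with n hn
  exact (ofReal_mul_weightedSup_le_iff hc (hd n)).2 hn

theorem ENNReal.le_mul_of_forall_lt_ofReal {X Y : ℝ≥0∞} {C : ℝ≥0} (hC : 0 < C)
    (h : ∀ c : ℝ, 0 < c → X < ENNReal.ofReal c → Y ≤ ENNReal.ofReal (C * c)) : Y ≤ C * X := by
  rcases eq_or_ne X ∞ with rfl | hX
  · rw [ENNReal.mul_top (by exact_mod_cast hC.ne')]
    exact le_top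
  refine ENNReal.le_of_forall_pos_le_add fun ε hε _ => ?_
  have hCr : (0 : ℝ) < C := hC
  have hεr : (0 : ℝ) < ε := hε
  have hpos : 0 < X.toReal + ε / C := add_pos_of_nonneg_of_pos ENNReal.toReal_nonneg (by positivity)
  refine (h _ hpos ?_).trans_eq ?_
  · rw [ENNReal.lt_ofReal_iff_toReal_lt hX]
    have : (0 : ℝ) < ε / C := by positivity
    linarith
  · rw [mul_add, mul_div_cancel₀ _ hCr.ne', ENNReal.ofReal_add (by positivity) hεr.le,
      ENNReal.ofReal_mul hCr.le, ENNReal.ofReal_toReal hX, ENNReal.ofReal_coe_nnreal,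
      ENNReal.ofReal_coe_nnreal]

/-- For `x` close to `1` there is a large `n` comparable to `1 / (1 - x)` with `x ^ n ≥ 1 / 2`. -/
theorem exists_pow_ge_half (N : ℕ) : ∃ ρ : ℝ, 0 ≤ ρ ∧ ρ < 1 ∧ ∀ x, ρ < x → x < 1 →
    ∃ n, N ≤ n ∧ 1 / 2 ≤ x ^ n ∧ (1 - x)⁻¹ ≤ 2 * ((n : ℝ) + 1) := by
  have hN : (0 : ℝ) < 2 * (N + 1) := by positivity
  have hN1 : (1 : ℝ) / (2 * (N + 1)) ≤ 1 := by
    rw [div_le_one hN]; linarith [N.cast_nonneg (α := ℝ)]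
  have hN2 : (0 : ℝ) < 1 / (2 * (N + 1)) := by positivity
  refine ⟨1 - 1 / (2 * (N + 1)), by linarith, by linarith, fun x hx hx1 => ?_⟩
  have h1x : 0 < 1 - x := by linarith
  have hpos : 0 < 1 / (2 * (1 - x)) := by positivity
  have h1 := Nat.floor_le hpos.le
  have h2 := Nat.lt_floor_add_one (1 / (2 * (1 - x)))
  -- Bernoulli's inequality gives `x^n ≥ 1 - n (1 - x) ≥ 1/2` for this `n`.
  refine ⟨⌊1 / (2 * (1 - x))⌋₊, Nat.le_floor ?_, ?_, ?_⟩
  · rw [le_div_iff₀ (by positivity)]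
    have h3 : (1 - x) * (2 * (N + 1)) < 1 := by
      rw [← lt_div_iff₀ hN]; linarith
    nlinarith [N.cast_nonneg (α := ℝ)]
  · have hb := one_add_mul_le_pow (a := x - 1) (by linarith) ⌊1 / (2 * (1 - x))⌋₊
    rw [add_sub_cancel] at hb
    rw [le_div_iff₀ (by positivity)] at h1
    linarith
  · rw [div_lt_iff₀ (by positivity)] at h2
    rw [inv_le_iff_one_le_mul₀ h1x]
    linarith

/-- From decay along powers to decay near the boundary. -/
theorem exists_weight_le_of_eventually {α c : ℝ} (hα : 0 < α) {ι : Type*} {a x : ι → ℝ}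
    (ha : ∀ i, 0 ≤ a i) (hx0 : ∀ i, 0 ≤ x i) (hx1 : ∀ i, x i < 1)
    (h : ∀ᶠ n : ℕ in atTop, ∀ i, ((n : ℝ) + 1) ^ α * (a i * x i ^ n) ≤ c) :
    ∃ ρ < 1, ∀ i, ρ < x i → a i ≤ 2 * 2 ^ α * c * (1 - x i ^ 2) ^ α := by
  obtain ⟨N, hN⟩ := eventually_atTop.1 h
  obtain ⟨ρ, -, hρ1, hρ⟩ := exists_pow_ge_half N
  refine ⟨ρ, hρ1, fun i hi => ?_⟩
  obtain ⟨n, hNn, hpow, hn⟩ := hρ (x i) hi (hx1 i)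
  have h1 := hN n hNn i
  have h1x : 0 < 1 - x i := by linarith [hx1 i]
  have hnpos : (0 : ℝ) < (n : ℝ) + 1 := by positivity
  have hnα : 0 < ((n : ℝ) + 1) ^ α := Real.rpow_pos_of_pos hnpos _
  have h2 : 1 ≤ 2 ^ α * ((n : ℝ) + 1) ^ α * (1 - x i ^ 2) ^ α := by
    have hsq : 0 ≤ 1 - x i ^ 2 := by nlinarith [hx0 i, hx1 i]
    rw [← Real.mul_rpow (by norm_num) hnpos.le, ← Real.mul_rpow (by positivity) hsq]
    refine Real.one_le_rpow ?_ hα.le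
    rw [inv_le_iff_one_le_mul₀ h1x] at hn
    have : 1 - x i ≤ 1 - x i ^ 2 := by nlinarith [hx0 i, hx1 i]
    nlinarith
  have h3 : ((n : ℝ) + 1) ^ α * a i ≤ 2 * c := by
    have : ((n : ℝ) + 1) ^ α * (a i * (1 / 2)) ≤ c := by
      refine le_trans ?_ h1
      have := ha i
      gcongr
    linarith
  have hw : 0 ≤ (1 - x i ^ 2) ^ α := Real.rpow_nonneg (by nlinarith [hx0 i, hx1 i]) _
  calc a i = a i * 1 := (mul_one _).symm
    _ ≤ a i * (2 ^ α * ((n : ℝ) + 1) ^ α * (1 - x i ^ 2) ^ α) := by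
        have := ha i
        gcongr
    _ = 2 ^ α * (((n : ℝ) + 1) ^ α * a i) * (1 - x i ^ 2) ^ α := by ring
    _ ≤ 2 ^ α * (2 * c) * (1 - x i ^ 2) ^ α := by gcongr
    _ = _ := by ring

theorem exists_log_le_of_eventually {c : ℝ} {ι : Type*} {a x : ι → ℝ}
    (ha : ∀ i, 0 ≤ a i) (hx1 : ∀ i, x i < 1)
    (h : ∀ᶠ n : ℕ in atTop, ∀ i, Real.log n * (a i * x i ^ n) ≤ c) :
    ∃ ρ < 1, ∀ i, ρ < x i → a i * -Real.log (1 - x i) ≤ 6 * c := by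
  obtain ⟨N, hN⟩ := eventually_atTop.1 h
  -- The shift by `2` ensures `n ≥ 2`, whence `1 / (1 - x) ≤ 2 (n + 1) ≤ n³`; the cube gives the
  -- factor `3`, and `x^n ≥ 1/2` doubles it to `6`.
  obtain ⟨ρ, -, hρ1, hρ⟩ := exists_pow_ge_half (N + 2)
  refine ⟨ρ, hρ1, fun i hi => ?_⟩
  obtain ⟨n, hNn, hpow, hn⟩ := hρ (x i) hi (hx1 i)
  have h1 := hN n (by omega) i
  have h1x : 0 < 1 - x i := by linarith [hx1 i]
  have hn2 : (2 : ℝ) ≤ n := by exact_mod_cast (by omega : 2 ≤ n)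
  have h2 : -Real.log (1 - x i) ≤ 3 * Real.log n := by
    rw [← Real.log_inv, show (3 : ℝ) * Real.log n = ((3 : ℕ) : ℝ) * Real.log n by norm_num,
      ← Real.log_pow]
    refine Real.log_le_log (inv_pos.2 h1x) (hn.trans ?_)
    nlinarith [mul_nonneg (by linarith : (0 : ℝ) ≤ n) (by nlinarith : (0 : ℝ) ≤ (n : ℝ) ^ 2 - 4)]
  have hlog : 0 ≤ Real.log n := Real.log_natCast_nonneg n
  have h3 : Real.log n * (a i * (1 / 2)) ≤ c := by
    refine le_trans ?_ h1
    have := ha i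
    gcongr
  calc a i * -Real.log (1 - x i) ≤ a i * (3 * Real.log n) := by
        have := ha i
        gcongr
    _ ≤ 6 * c := by linarith

theorem hasDerivAt_neg_log_one_sub {t : ℝ} (ht : t < 1) :
    HasDerivAt (fun t => -Real.log (1 - t)) ((1 - t) ^ (-1 : ℝ)) t := by
  have h1 : HasDerivAt (fun t : ℝ => 1 - t) (-1) t := by
    simpa using (hasDerivAt_id t).const_sub 1
  refine ((h1.log (by linarith)).neg).congr_deriv ?_
  rw [Real.rpow_neg_one, neg_div, neg_neg, one_div]

theorem hasDerivAt_one_sub_rpow_div {α t : ℝ} (hα : α ≠ 1) (ht : t < 1) :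
    HasDerivAt (fun t => (1 - t) ^ (1 - α) / (α - 1)) ((1 - t) ^ (-α)) t := by
  have h1 : HasDerivAt (fun t : ℝ => 1 - t) (-1) t := by
    simpa using (hasDerivAt_id t).const_sub 1
  refine ((h1.rpow_const (p := 1 - α) (Or.inl (by linarith))).div_const (α - 1)).congr_deriv ?_
  have : α - 1 ≠ 0 := sub_ne_zero.2 hα
  rw [show 1 - α - 1 = -α by ring]
  field_simp
  ring

/-! ### Upper bounds for the essential norm in the three ranges of `α`. -/

namespace IsVolterraComp

variable {α β : ℝ} {g φ : ℂ → ℂ} {T : Zygmund α →L[ℂ] Zygmund β}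

theorem norm_lt_one (hT : IsVolterraComp g φ T) {z : ℂ} (hz : z ∈ ball (0 : ℂ) 1) : ‖φ z‖ < 1 :=
  mem_ball_zero_iff.1 (hT.mapsTo hz)

theorem exists_boundary_le (hT : IsVolterraComp g φ T) {γ : ℝ} (hγ : 0 < γ) {c : ℝ} {u : ℂ → ℂ}
    (h : ∀ᶠ n : ℕ in atTop, ∀ z ∈ ball (0 : ℂ) 1,
      ((n : ℝ) + 1) ^ γ * ((1 - ‖z‖ ^ 2) ^ β * ‖u z‖ * ‖φ z‖ ^ n) ≤ c) :
    ∃ ρ < 1, ∀ z ∈ ball (0 : ℂ) 1, ρ < ‖φ z‖ →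
      (1 - ‖z‖ ^ 2) ^ β * ‖u z‖ ≤ 2 * 2 ^ γ * c * (1 - ‖φ z‖ ^ 2) ^ γ := by
  obtain ⟨ρ, hρ, h'⟩ := exists_weight_le_of_eventually hγ (ι := ball (0 : ℂ) 1)
    (a := fun z => (1 - ‖(z : ℂ)‖ ^ 2) ^ β * ‖u z‖) (x := fun z => ‖φ z‖) (c := c)
    (fun z => mul_nonneg (Real.rpow_nonneg (one_sub_norm_sq_pos z.2).le _) (norm_nonneg _))
    (fun z => norm_nonneg _) (fun z => hT.norm_lt_one z.2)
    (h.mono fun n hn z => hn z z.2)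
  exact ⟨ρ, hρ, fun z hz => h' ⟨z, hz⟩⟩

/-- Subadditivity of `t ↦ t^(1 - α)` bounds the increment of `ψ` by `(1 - r)^(1 - α) / (1 - α)`,
which tends to `0` as `r → 1` uniformly in the point. Mere boundedness of the weighted `g'` then
suffices, so no limsup for `g'` enters. -/
theorem essNorm_le_of_lt_one (hT : IsVolterraComp g φ T) (hα : 0 < α) (hα1 : α < 1) {c : ℝ}
    (hc : 0 < c)
    (hu : limsupPow β (fun n => ((n : ℝ) + 1) ^ α) (fun z => g z * deriv φ z) φ
      < ENNReal.ofReal c) :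
    essNorm T ≤ ENNReal.ofReal (6 * (2 * 2 ^ α * c)) := by
  obtain ⟨ρ, hρ, hu'⟩ := hT.exists_boundary_le hα
    (eventually_of_limsupPow_lt hc.le (fun n => by positivity) hu)
  obtain ⟨M, hM, hMb⟩ := hT.exists_bound hα
  set A := 2 * 2 ^ α * c with hA
  have hApos : 0 < A := by positivity
  have h1α : 0 < 1 - α := by linarith
  have hcont : Continuous fun r : ℝ => M * ((1 - r) ^ (1 - α) / (1 - α)) :=
    (((by fun_prop : Continuous fun r : ℝ => 1 - r).rpow_const fun _ => Or.inr h1α.le).div_const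
      _).const_mul M
  have hev : ∀ᶠ r in nhds (1 : ℝ), M * ((1 - r) ^ (1 - α) / (1 - α)) < A := by
    refine hcont.continuousAt.eventually (gt_mem_nhds ?_)
    simpa [Real.zero_rpow h1α.ne'] using hApos
  obtain ⟨δ, hδ, hev'⟩ := Metric.eventually_nhds_iff.1 hev
  refine hT.essNorm_le hα (ψ := fun t => (1 - t) ^ (1 - α) / (α - 1))
    (fun t _ ht => hasDerivAt_one_sub_rpow_div hα1.ne ht) hApos hρ
    (r₀ := 1 - δ) (by linarith) hu' fun r hr hr0 hr1 z hz _ => ?_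
  have hx0 := norm_nonneg (φ z)
  have hx1 := hT.norm_lt_one hz
  have h1 : (1 - ‖φ z‖) ^ (1 - α) / (α - 1) - (1 - r * ‖φ z‖) ^ (1 - α) / (α - 1) ≤
      (1 - r) ^ (1 - α) / (1 - α) := by
    have h2 : (1 - r * ‖φ z‖) ^ (1 - α) ≤ (1 - ‖φ z‖) ^ (1 - α) + (1 - r) ^ (1 - α) := by
      have h3 := Real.rpow_add_le_add_rpow (p := 1 - α) (a := 1 - ‖φ z‖) (b := (1 - r) * ‖φ z‖)
        (by linarith) (mul_nonneg (by linarith) hx0) h1α.le (by linarith)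
      rw [show 1 - ‖φ z‖ + (1 - r) * ‖φ z‖ = 1 - r * ‖φ z‖ by ring] at h3
      refine h3.trans ?_
      gcongr
      exact mul_le_of_le_one_right (by linarith) hx1.le
    rw [← sub_div, ← neg_sub 1 α, div_neg, ← neg_div]
    gcongr
    linarith
  have h2 := hev' (y := r) (by rw [Real.dist_eq, abs_lt]; constructor <;> linarith)
  have h3 := (hMb z hz).2
  have h4 : 0 ≤ (1 - r) ^ (1 - α) / (1 - α) := by
    have : 0 ≤ (1 - r) ^ (1 - α) := Real.rpow_nonneg (by linarith) _
    positivity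
  have h5 : 0 ≤ (1 - ‖z‖ ^ 2) ^ β * ‖deriv g z‖ :=
    mul_nonneg (Real.rpow_nonneg (one_sub_norm_sq_pos hz).le _) (norm_nonneg _)
  calc _ ≤ (1 - ‖z‖ ^ 2) ^ β * ‖deriv g z‖ * ((1 - r) ^ (1 - α) / (1 - α)) := by gcongr
    _ ≤ M * ((1 - r) ^ (1 - α) / (1 - α)) := by gcongr
    _ ≤ A := h2.le

/-- Here `ψ (r x) ≥ 0`, so the increment is at most `-log (1 - x)`, exactly what the logarithmic
limsup controls near the boundary. -/
theorem essNorm_le_of_eq_one {T : Zygmund 1 →L[ℂ] Zygmund β} (hT : IsVolterraComp g φ T) {c : ℝ}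
    (hc : 0 < c)
    (hu : limsupPow β (fun n => (n : ℝ) + 1) (fun z => g z * deriv φ z) φ < ENNReal.ofReal c)
    (hw : limsupPow β (fun n => Real.log n) (deriv g) φ < ENNReal.ofReal c) :
    essNorm T ≤ ENNReal.ofReal (36 * c) := by
  obtain ⟨ρ₁, hρ₁, hu'⟩ := hT.exists_boundary_le one_pos (u := fun z => g z * deriv φ z) (c := c)
    (by simpa only [Real.rpow_one] using
      eventually_of_limsupPow_lt hc.le (fun n => by positivity) hu)
  obtain ⟨ρ₂, hρ₂, hw'⟩ := exists_log_le_of_eventually (ι := ball (0 : ℂ) 1)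
    (a := fun z => (1 - ‖(z : ℂ)‖ ^ 2) ^ β * ‖deriv g z‖) (x := fun z => ‖φ z‖) (c := c)
    (fun z => mul_nonneg (Real.rpow_nonneg (one_sub_norm_sq_pos z.2).le _) (norm_nonneg _))
    (fun z => hT.norm_lt_one z.2)
    ((eventually_of_limsupPow_lt hc.le (fun n => Real.log_natCast_nonneg n) hw).mono
      fun n hn z => hn z z.2)
  have h := hT.essNorm_le one_pos (ψ := fun t => -Real.log (1 - t))
    (fun t _ ht => hasDerivAt_neg_log_one_sub ht) (A := 6 * c) (ρ := max ρ₁ ρ₂) (r₀ := 0)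
    (by positivity) (max_lt hρ₁ hρ₂) one_pos
    (fun z hz hρz => ?_) (fun r _ hr0 hr1 z hz hρz => ?_)
  · refine h.trans_eq ?_
    ring_nf
  · refine (hu' z hz ((le_max_left _ _).trans_lt hρz)).trans ?_
    rw [Real.rpow_one, Real.rpow_one]
    have := one_sub_norm_sq_pos (hT.mapsTo hz)
    gcongr
    norm_num
  · refine le_trans ?_ (hw' ⟨z, hz⟩ ((le_max_right _ _).trans_lt hρz))
    have h5 : 0 ≤ (1 - ‖z‖ ^ 2) ^ β * ‖deriv g z‖ :=
      mul_nonneg (Real.rpow_nonneg (one_sub_norm_sq_pos hz).le _) (norm_nonneg _)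
    have h6 : Real.log (1 - r * ‖φ z‖) ≤ 0 := by
      have h7 : r * ‖φ z‖ < 1 := by nlinarith [norm_nonneg (φ z), hT.norm_lt_one hz]
      exact Real.log_nonpos (by linarith) (by nlinarith [norm_nonneg (φ z)])
    refine mul_le_mul_of_nonneg_left ?_ h5
    linarith

/-- The increment is at most `(1 - x)^(1 - α) / (α - 1)`, which cancels the decay `(1 - x²)^(α - 1)`
of the weighted `g'`. -/
theorem essNorm_le_of_one_lt (hT : IsVolterraComp g φ T) (hα1 : 1 < α) {c : ℝ} (hc : 0 < c)
    (hu : limsupPow β (fun n => ((n : ℝ) + 1) ^ α) (fun z => g z * deriv φ z) φ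
      < ENNReal.ofReal c)
    (hw : limsupPow β (fun n => ((n : ℝ) + 1) ^ (α - 1)) (deriv g) φ < ENNReal.ofReal c) :
    essNorm T ≤ ENNReal.ofReal (6 * (2 * 2 ^ α * c + 2 * 2 ^ (α - 1) * c * 2 ^ (α - 1) / (α - 1))) := by
  have hα : 0 < α := by linarith
  have hα' : 0 < α - 1 := by linarith
  obtain ⟨ρ₁, hρ₁, hu'⟩ := hT.exists_boundary_le hα
    (eventually_of_limsupPow_lt hc.le (fun n => by positivity) hu)
  obtain ⟨ρ₂, hρ₂, hw'⟩ := hT.exists_boundary_le hα'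
    (eventually_of_limsupPow_lt hc.le (fun n => by positivity) hw)
  refine hT.essNorm_le hα (ψ := fun t => (1 - t) ^ (1 - α) / (α - 1))
    (fun t _ ht => hasDerivAt_one_sub_rpow_div hα1.ne' ht) (ρ := max ρ₁ ρ₂) (r₀ := 0)
    (by positivity) (max_lt hρ₁ hρ₂) one_pos
    (fun z hz hρz => ?_) (fun r _ hr0 hr1 z hz hρz => ?_)
  · refine (hu' z hz ((le_max_left _ _).trans_lt hρz)).trans ?_
    have := Real.rpow_nonneg (one_sub_norm_sq_pos (hT.mapsTo hz)).le α
    gcongr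
    have : 0 ≤ 2 * 2 ^ (α - 1) * c * 2 ^ (α - 1) / (α - 1) := by positivity
    linarith
  · have hx0 := norm_nonneg (φ z)
    have hx1 := hT.norm_lt_one hz
    have h1x : 0 < 1 - ‖φ z‖ := by linarith
    have h1 := hw' z hz ((le_max_right _ _).trans_lt hρz)
    have h5 : 0 ≤ (1 - ‖z‖ ^ 2) ^ β * ‖deriv g z‖ :=
      mul_nonneg (Real.rpow_nonneg (one_sub_norm_sq_pos hz).le _) (norm_nonneg _)
    have h6 : 0 ≤ (1 - r * ‖φ z‖) ^ (1 - α) / (α - 1) := by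
      have : 0 ≤ (1 - r * ‖φ z‖) ^ (1 - α) := Real.rpow_nonneg (by nlinarith) _
      positivity
    have h7 : (1 - ‖φ z‖ ^ 2) ^ (α - 1) ≤ 2 ^ (α - 1) * (1 - ‖φ z‖) ^ (α - 1) := by
      rw [← Real.mul_rpow (by norm_num) h1x.le]
      exact Real.rpow_le_rpow (by nlinarith) (by nlinarith) hα'.le
    have h8 : (1 - ‖φ z‖) ^ (α - 1) * (1 - ‖φ z‖) ^ (1 - α) = 1 := by
      rw [← Real.rpow_add h1x]; simp
    have h9 : 0 ≤ (1 - ‖φ z‖) ^ (1 - α) := Real.rpow_nonneg h1x.le _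
    calc (1 - ‖z‖ ^ 2) ^ β * ‖deriv g z‖ * ((1 - ‖φ z‖) ^ (1 - α) / (α - 1) -
          (1 - r * ‖φ z‖) ^ (1 - α) / (α - 1))
        ≤ (1 - ‖z‖ ^ 2) ^ β * ‖deriv g z‖ * ((1 - ‖φ z‖) ^ (1 - α) / (α - 1)) := by
          gcongr; linarith
      _ ≤ (2 * 2 ^ (α - 1) * c * (2 ^ (α - 1) * (1 - ‖φ z‖) ^ (α - 1))) *
            ((1 - ‖φ z‖) ^ (1 - α) / (α - 1)) := by
          refine mul_le_mul_of_nonneg_right (h1.trans (by gcongr)) (by positivity)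
      _ = 2 * 2 ^ (α - 1) * c * 2 ^ (α - 1) *
            ((1 - ‖φ z‖) ^ (α - 1) * (1 - ‖φ z‖) ^ (1 - α)) / (α - 1) := by ring
      _ = 2 * 2 ^ (α - 1) * c * 2 ^ (α - 1) / (α - 1) := by rw [h8, mul_one]
      _ ≤ _ := by
          have : 0 ≤ 2 * 2 ^ α * c := by positivity
          linarith

end IsVolterraComp

/-! ### Lower bounds for the essential norm. -/

/-- The constant in the estimates obtained by testing on monomials. -/
noncomputable def monomialConst (α : ℝ) : ℝ := 2 ^ α * (α ^ α * Real.exp 1) + 1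

theorem monomialConst_pos {α : ℝ} (hα : 0 < α) : 0 < monomialConst α := by
  unfold monomialConst; positivity

/-- The constant in the estimate of `g'` by the essential norm. -/
noncomputable def derivSymbolConst (α : ℝ) : ℝ :=
  (1 + 4 ^ (α - 1)) * ((2 + (2 ^ (α - 1))⁻¹) * monomialConst α)

theorem derivSymbolConst_pos {α : ℝ} (hα : 0 < α) : 0 < derivSymbolConst α := by
  have := monomialConst_pos hα
  unfold derivSymbolConst; positivity

namespace IsVolterraComp

variable {α β : ℝ} {g φ : ℂ → ℂ} {T : Zygmund α →L[ℂ] Zygmund β}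

theorem eventually_monomial_le (hT : IsVolterraComp g φ T) (hα : 0 < α) {c : ℝ} (hc : 0 < c)
    (hess : essNorm T < ENNReal.ofReal c) :
    ∀ᶠ n : ℕ in atTop, ∀ z ∈ ball (0 : ℂ) 1, (1 - ‖z‖ ^ 2) ^ β *
      ‖((((n : ℝ) + 1) ^ α : ℝ) : ℂ) * φ z ^ n * (g z * deriv φ z) +
        ((((n : ℝ) + 1) ^ (α - 1) : ℝ) : ℂ) * φ z ^ (n + 1) * deriv g z‖ ≤
      monomialConst α * c := by
  have h := hT.eventually_testSeq_le hα (isTestSeq_monomial hα) hc hess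
  simp only [deriv_rpow_mul_monomial] at h
  exact h

/-- In the test expressions `X` and `Y` for indices `n` and `2n + 1`, the ratios of the `gφ'`
coefficient to the `g'` coefficient differ by a factor `2`, up to powers of `φ`. Hence `2κ φ^(n+1) X
- Y` cancels `gφ'` and leaves a multiple of `φ^(2n+2) g'`. -/
theorem eventually_deriv_symbol_le (hT : IsVolterraComp g φ T) (hα : 0 < α) {c : ℝ} (hc : 0 < c)
    (hess : essNorm T < ENNReal.ofReal c) :
    ∀ᶠ n : ℕ in atTop, ∀ z ∈ ball (0 : ℂ) 1,
      ((n : ℝ) + 1) ^ (α - 1) * ((1 - ‖z‖ ^ 2) ^ β * ‖deriv g z‖ * ‖φ z‖ ^ n) ≤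
        derivSymbolConst α * c := by
  obtain ⟨N, hN⟩ := eventually_atTop.1 (hT.eventually_monomial_le hα hc hess)
  filter_upwards [eventually_ge_atTop (2 * N + 2)] with m hm z hz
  -- Every large `m` is `2n + 2` or `2n + 3`, so `|φ|^m ≤ |φ|^(2n+2)` and `m + 1` lies between `n +
  -- 1` and `4 (n + 1)`.
  obtain ⟨n, hnN, hnm, hmn⟩ : ∃ n, N ≤ n ∧ 2 * n + 2 ≤ m ∧ m ≤ 2 * n + 3 :=
    ⟨m / 2 - 1, by omega, by omega, by omega⟩
  have h1 := hN n hnN z hz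
  have h2 := hN (2 * n + 1) (by omega) z hz
  have hDc : 0 < monomialConst α * c := mul_pos (monomialConst_pos hα) hc
  have hφ1 := (hT.norm_lt_one hz).le
  have hw0 : 0 ≤ (1 - ‖z‖ ^ 2) ^ β := Real.rpow_nonneg (one_sub_norm_sq_pos hz).le _
  have hn0 : (0 : ℝ) < (n : ℝ) + 1 := by positivity
  set a := ((n : ℝ) + 1) ^ (α - 1) with ha
  set κ := (2 : ℝ) ^ (α - 1) with hκ
  have ha0 : 0 < a := Real.rpow_pos_of_pos hn0 _
  have hκ0 : 0 < κ := Real.rpow_pos_of_pos two_pos _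
  have e1 : ((n : ℝ) + 1) ^ α = a * (n + 1) := by
    rw [ha, ← Real.rpow_add_one hn0.ne', sub_add_cancel]
  have e2 : (((2 * n + 1 : ℕ) : ℝ) + 1) = 2 * ((n : ℝ) + 1) := by push_cast; ring
  have e3 : (((2 * n + 1 : ℕ) : ℝ) + 1) ^ (α - 1) = κ * a := by
    rw [e2, Real.mul_rpow two_pos.le hn0.le]
  have e4 : (((2 * n + 1 : ℕ) : ℝ) + 1) ^ α = κ * a * (2 * (n + 1)) := by
    rw [← e3, ← e2, ← Real.rpow_add_one (by positivity), sub_add_cancel]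
  rw [e1] at h1
  rw [e3, e4] at h2
  set X := ((a * ((n : ℝ) + 1) : ℝ) : ℂ) * φ z ^ n * (g z * deriv φ z) +
    (a : ℂ) * φ z ^ (n + 1) * deriv g z with hX
  set Y := ((κ * a * (2 * ((n : ℝ) + 1)) : ℝ) : ℂ) * φ z ^ (2 * n + 1) * (g z * deriv φ z) +
    ((κ * a : ℝ) : ℂ) * φ z ^ (2 * n + 1 + 1) * deriv g z with hY
  have hXY : ((κ * a : ℝ) : ℂ) * φ z ^ (2 * n + 2) * deriv g z =
      ((2 * κ : ℝ) : ℂ) * φ z ^ (n + 1) * X - Y := by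
    rw [hX, hY]; push_cast; ring
  have hnorm : κ * a * ‖φ z‖ ^ (2 * n + 2) * ‖deriv g z‖ ≤ 2 * κ * ‖X‖ + ‖Y‖ := by
    calc κ * a * ‖φ z‖ ^ (2 * n + 2) * ‖deriv g z‖
        = ‖((κ * a : ℝ) : ℂ) * φ z ^ (2 * n + 2) * deriv g z‖ := by
          rw [norm_mul, norm_mul, norm_pow, Complex.norm_real, Real.norm_of_nonneg (by positivity)]
      _ ≤ ‖((2 * κ : ℝ) : ℂ) * φ z ^ (n + 1) * X‖ + ‖Y‖ := by rw [hXY]; exact norm_sub_le _ _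
      _ ≤ _ := by
          rw [norm_mul, norm_mul, norm_pow, Complex.norm_real, Real.norm_of_nonneg (by positivity)]
          have h4 : 2 * κ * ‖φ z‖ ^ (n + 1) ≤ 2 * κ :=
            mul_le_of_le_one_right (by positivity) (pow_le_one₀ (norm_nonneg _) hφ1)
          gcongr
  have h3 : a * ((1 - ‖z‖ ^ 2) ^ β * ‖deriv g z‖ * ‖φ z‖ ^ (2 * n + 2)) ≤
      (2 + κ⁻¹) * (monomialConst α * c) := by
    have h4 := mul_le_mul_of_nonneg_left hnorm hw0
    have h5 : κ * (a * ((1 - ‖z‖ ^ 2) ^ β * ‖deriv g z‖ * ‖φ z‖ ^ (2 * n + 2))) ≤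
        κ * ((2 + κ⁻¹) * (monomialConst α * c)) := by
      have h6 : κ * ((2 + κ⁻¹) * (monomialConst α * c)) =
          2 * κ * (monomialConst α * c) + monomialConst α * c := by field_simp
      rw [h6]
      have h7 := mul_le_mul_of_nonneg_left h1 (by positivity : 0 ≤ 2 * κ)
      linarith
    exact le_of_mul_le_mul_left h5 hκ0
  -- The constant `1 + 4^(α - 1)` covers both signs of `α - 1`.
  have h8 : ((m : ℝ) + 1) ^ (α - 1) ≤ (1 + 4 ^ (α - 1)) * a := by
    have h4 : (0 : ℝ) < 4 ^ (α - 1) := by positivity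
    have hm1 : (n : ℝ) + 1 ≤ (m : ℝ) + 1 := by
      have : n ≤ m := by omega
      have : (n : ℝ) ≤ m := by exact_mod_cast this
      linarith
    have hm2 : (m : ℝ) + 1 ≤ 4 * ((n : ℝ) + 1) := by
      have : (m : ℝ) ≤ 2 * n + 3 := by exact_mod_cast hmn
      linarith [n.cast_nonneg (α := ℝ)]
    rcases le_total 0 (α - 1) with hs | hs
    · calc _ ≤ (4 * ((n : ℝ) + 1)) ^ (α - 1) := Real.rpow_le_rpow (by positivity) hm2 hs
        _ = 4 ^ (α - 1) * a := Real.mul_rpow (by norm_num) hn0.le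
        _ ≤ _ := by gcongr; linarith
    · calc _ ≤ a := Real.rpow_le_rpow_of_nonpos hn0 hm1 hs
        _ = 1 * a := (one_mul a).symm
        _ ≤ _ := by gcongr; linarith
  calc ((m : ℝ) + 1) ^ (α - 1) * ((1 - ‖z‖ ^ 2) ^ β * ‖deriv g z‖ * ‖φ z‖ ^ m)
      ≤ ((1 + 4 ^ (α - 1)) * a) * ((1 - ‖z‖ ^ 2) ^ β * ‖deriv g z‖ * ‖φ z‖ ^ (2 * n + 2)) := by
        gcongr ?_ * (_ * ?_)
        exact pow_le_pow_of_le_one (norm_nonneg _) hφ1 hnm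
    _ = (1 + 4 ^ (α - 1)) *
          (a * ((1 - ‖z‖ ^ 2) ^ β * ‖deriv g z‖ * ‖φ z‖ ^ (2 * n + 2))) := by ring
    _ ≤ (1 + 4 ^ (α - 1)) * ((2 + κ⁻¹) * (monomialConst α * c)) := by gcongr
    _ = _ := by rw [derivSymbolConst]; ring

theorem eventually_symbol_mul_deriv_le (hT : IsVolterraComp g φ T) (hα : 0 < α) {c : ℝ}
    (hc : 0 < c) (hess : essNorm T < ENNReal.ofReal c) :
    ∀ᶠ n : ℕ in atTop, ∀ z ∈ ball (0 : ℂ) 1,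
      ((n : ℝ) + 1) ^ α * ((1 - ‖z‖ ^ 2) ^ β * ‖g z * deriv φ z‖ * ‖φ z‖ ^ n) ≤
        (monomialConst α + derivSymbolConst α) * c := by
  filter_upwards [hT.eventually_monomial_le hα hc hess,
    hT.eventually_deriv_symbol_le hα hc hess] with n h1 h2 z hz
  have hw0 : 0 ≤ (1 - ‖z‖ ^ 2) ^ β := Real.rpow_nonneg (one_sub_norm_sq_pos hz).le _
  have h1' := h1 z hz
  have h2' := h2 z hz
  set X := ((((n : ℝ) + 1) ^ α : ℝ) : ℂ) * φ z ^ n * (g z * deriv φ z) with hX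
  set Y := ((((n : ℝ) + 1) ^ (α - 1) : ℝ) : ℂ) * φ z ^ (n + 1) * deriv g z with hY
  have hXn : ‖X‖ = ((n : ℝ) + 1) ^ α * ‖φ z‖ ^ n * ‖g z * deriv φ z‖ := by
    rw [hX, norm_mul, norm_mul _ (φ z ^ n), norm_pow, Complex.norm_real,
      Real.norm_of_nonneg (by positivity)]
  have hYn : ‖Y‖ ≤ ((n : ℝ) + 1) ^ (α - 1) * ‖φ z‖ ^ n * ‖deriv g z‖ := by
    rw [hY, norm_mul, norm_mul, norm_pow, Complex.norm_real, Real.norm_of_nonneg (by positivity)]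
    gcongr ?_ * ?_ * ?_
    exact pow_le_pow_of_le_one (norm_nonneg _) (hT.norm_lt_one hz).le n.le_succ
  have h3 : ‖X‖ ≤ ‖X + Y‖ + ‖Y‖ := by
    simpa using norm_sub_le (X + Y) Y
  calc _ = (1 - ‖z‖ ^ 2) ^ β * ‖X‖ := by rw [hXn]; ring
    _ ≤ (1 - ‖z‖ ^ 2) ^ β * (‖X + Y‖ +
          ((n : ℝ) + 1) ^ (α - 1) * ‖φ z‖ ^ n * ‖deriv g z‖) := by gcongr; linarith
    _ ≤ _ := by
        rw [mul_add, add_mul]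
        refine add_le_add h1' ?_
        linarith

/-- The `gφ'` term in the test inequality is at most `c` where `|φ| ≤ ρ`, by local uniform
convergence, and at most `4 · 12 E c` elsewhere, by the boundary decay of `gφ'`. Together with `(12
+ 1) c` from the test sequence this gives `14 + 48 E`. -/
theorem eventually_log_le {T : Zygmund 1 →L[ℂ] Zygmund β} (hT : IsVolterraComp g φ T) {c : ℝ}
    (hc : 0 < c) (hess : essNorm T < ENNReal.ofReal c) :
    ∀ᶠ n : ℕ in atTop, ∀ z ∈ ball (0 : ℂ) 1,
      Real.log n * ((1 - ‖z‖ ^ 2) ^ β * ‖deriv g z‖ * ‖φ z‖ ^ (2 * n)) ≤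
        (14 + 48 * (monomialConst 1 + derivSymbolConst 1)) * c := by
  set E := monomialConst 1 + derivSymbolConst 1 with hE
  have hE0 : 0 < E := add_pos (monomialConst_pos one_pos) (derivSymbolConst_pos one_pos)
  obtain ⟨ρ, hρ, hu⟩ := hT.exists_boundary_le one_pos
    (hT.eventually_symbol_mul_deriv_le one_pos hc hess)
  obtain ⟨M, hM, hMb⟩ := hT.exists_bound one_pos
  by_contra hcon
  -- The rotation must suit the point being tested, yet a test sequence fixes one rotation per `n`.
  -- So `z n` is a violating point whenever one exists, and `e n` turns `φ (z n)` onto the positive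
  -- axis.
  have hch : ∀ n : ℕ, ∃ z ∈ ball (0 : ℂ) 1, (∀ z' ∈ ball (0 : ℂ) 1, (14 + 48 * E) * c <
      Real.log n * ((1 - ‖z'‖ ^ 2) ^ β * ‖deriv g z'‖ * ‖φ z'‖ ^ (2 * n)) → (14 + 48 * E) * c <
      Real.log n * ((1 - ‖z‖ ^ 2) ^ β * ‖deriv g z‖ * ‖φ z‖ ^ (2 * n))) := fun n => by
    by_cases h : ∃ z ∈ ball (0 : ℂ) 1, (14 + 48 * E) * c <
      Real.log n * ((1 - ‖z‖ ^ 2) ^ β * ‖deriv g z‖ * ‖φ z‖ ^ (2 * n))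
    · obtain ⟨z, hz, h⟩ := h
      exact ⟨z, hz, fun _ _ _ => h⟩
    · exact ⟨0, by simp, fun z' hz' h' => absurd ⟨z', hz', h'⟩ h⟩
  choose z hz hbad using hch
  choose e he heφ using fun n => Complex.exists_norm_eq_mul_self (φ (z n))
  have hF := isTestSeq_log he
  apply hcon
  filter_upwards [hT.eventually_testSeq_le one_pos hF hc hess,
    hF.eventually_le ρ hρ (c / M) (by positivity), eventually_ge_atTop 2] with n h1 h2 hn2
  by_contra hfail
  push Not at hfail
  obtain ⟨z', hz', hfail⟩ := hfail
  have hb := hbad n z' hz' hfail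
  have h1 := h1 (z n) (hz n)
  have hφ := hT.mapsTo (hz n)
  have hx1 := hT.norm_lt_one (hz n)
  have hwt := hF.weight_mul_le n _ hφ
  have hu := hu (z n) (hz n)
  have h2 := h2 (φ (z n))
  obtain ⟨hMu, -⟩ := hMb (z n) (hz n)
  have hw0 : 0 ≤ (1 - ‖z n‖ ^ 2) ^ β := Real.rpow_nonneg (one_sub_norm_sq_pos (hz n)).le _
  have hFφ : ‖φ (z n)‖ ^ (2 * n) * Real.log n ≤
      ‖logPoly n (e n * φ (z n)) ^ 2 / ((Real.log n : ℝ) : ℂ)‖ := by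
    have hlog : 0 < Real.log n := Real.log_pos (by exact_mod_cast hn2)
    have h3 := pow_mul_log_le_norm_logPoly n (norm_nonneg (φ (z n))) hx1.le
    rw [← heφ n, norm_div, norm_pow, Complex.norm_real, Real.norm_of_nonneg hlog.le,
      le_div_iff₀ hlog]
    calc _ = (‖φ (z n)‖ ^ n * Real.log n) ^ 2 := by ring
      _ ≤ _ := by gcongr
  set F' := deriv (fun z => logPoly n (e n * z) ^ 2 / ((Real.log n : ℝ) : ℂ)) (φ (z n)) with hF'
  set F₀ := logPoly n (e n * φ (z n)) ^ 2 / ((Real.log n : ℝ) : ℂ) with hF₀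
  set m := (1 - ‖z n‖ ^ 2) ^ β with hm
  set U := g (z n) * deriv φ (z n) with hU
  set W := deriv g (z n) with hW
  rw [Real.rpow_one] at hwt
  simp only [Real.rpow_one] at hu
  have hUF : m * ‖U‖ * ‖F'‖ ≤ (1 + 48 * E) * c := by
    rcases le_or_gt ‖φ (z n)‖ ρ with hle | hgt
    · calc m * ‖U‖ * ‖F'‖ ≤ M * (c / M) := by
            gcongr
            exact h2 hle
        _ = 1 * c := by rw [one_mul]; exact mul_div_cancel₀ _ hM.ne'
        _ ≤ (1 + 48 * E) * c := by gcongr; linarith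
    · calc m * ‖U‖ * ‖F'‖ ≤ (2 * 2 * (E * c) * (1 - ‖φ (z n)‖ ^ 2)) * ‖F'‖ :=
            mul_le_mul_of_nonneg_right (hu hgt) (norm_nonneg _)
        _ = 2 * 2 * (E * c) * ((1 - ‖φ (z n)‖ ^ 2) * ‖F'‖) := by ring
        _ ≤ 2 * 2 * (E * c) * 12 := by gcongr
        _ ≤ (1 + 48 * E) * c := by nlinarith
  have htri : ‖F₀‖ * ‖W‖ ≤ ‖F' * U + F₀ * W‖ + ‖U‖ * ‖F'‖ := by
    have := norm_sub_le (F' * U + F₀ * W) (F' * U)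
    rw [add_sub_cancel_left, norm_mul, norm_mul F'] at this
    linarith
  have hfin : Real.log n * (m * ‖W‖ * ‖φ (z n)‖ ^ (2 * n)) ≤ (14 + 48 * E) * c := by
    calc _ = m * ((‖φ (z n)‖ ^ (2 * n) * Real.log n) * ‖W‖) := by ring
      _ ≤ m * (‖F₀‖ * ‖W‖) := by gcongr
      _ ≤ m * (‖F' * U + F₀ * W‖ + ‖U‖ * ‖F'‖) := by gcongr
      _ = m * ‖F' * U + F₀ * W‖ + m * ‖U‖ * ‖F'‖ := by ring
      _ ≤ (12 + 1) * c + (1 + 48 * E) * c := by gcongr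
      _ = _ := by ring
  exact absurd hb (not_lt.2 hfin)

theorem limsupPow_symbol_le (hT : IsVolterraComp g φ T) (hα : 0 < α) {c : ℝ}
    (hc : 0 < c) (hess : essNorm T < ENNReal.ofReal c) :
    limsupPow β (fun n => ((n : ℝ) + 1) ^ α) (fun z => g z * deriv φ z) φ ≤
      ENNReal.ofReal ((monomialConst α + derivSymbolConst α) * c) :=
  limsupPow_le_of_eventually
    (mul_pos (add_pos (monomialConst_pos hα) (derivSymbolConst_pos hα)) hc).le
    (fun n => by positivity) (hT.eventually_symbol_mul_deriv_le hα hc hess)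

theorem limsupPow_deriv_symbol_le (hT : IsVolterraComp g φ T) (hα : 0 < α) {c : ℝ}
    (hc : 0 < c) (hess : essNorm T < ENNReal.ofReal c) :
    limsupPow β (fun n => ((n : ℝ) + 1) ^ (α - 1)) (deriv g) φ ≤
      ENNReal.ofReal (derivSymbolConst α * c) :=
  limsupPow_le_of_eventually (mul_pos (derivSymbolConst_pos hα) hc).le
    (fun n => by positivity) (hT.eventually_deriv_symbol_le hα hc hess)

/-- To pass from exponents `2n` to all `m`, take `n = m / 2`: `m ≤ 2n + 1 ≤ n²` for `n ≥ 3`, so `log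
m ≤ 2 log n`. -/
theorem limsupPow_log_le {T : Zygmund 1 →L[ℂ] Zygmund β} (hT : IsVolterraComp g φ T) {c : ℝ}
    (hc : 0 < c) (hess : essNorm T < ENNReal.ofReal c) :
    limsupPow β (fun n => Real.log n) (deriv g) φ ≤
      ENNReal.ofReal (2 * (14 + 48 * (monomialConst 1 + derivSymbolConst 1)) * c) := by
  have hE := add_pos (monomialConst_pos one_pos) (derivSymbolConst_pos one_pos)
  refine limsupPow_le_of_eventually (by positivity) (fun n => Real.log_natCast_nonneg n) ?_
  obtain ⟨N, hN⟩ := eventually_atTop.1 (hT.eventually_log_le hc hess)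
  filter_upwards [eventually_ge_atTop (2 * N + 6)] with m hm z hz
  obtain ⟨n, hnN, hn3, hnm, hmn⟩ : ∃ n, N ≤ n ∧ 3 ≤ n ∧ 2 * n ≤ m ∧ m ≤ 2 * n + 1 :=
    ⟨m / 2, by omega, by omega, by omega, by omega⟩
  have h1 := hN n hnN z hz
  have hw0 : 0 ≤ (1 - ‖z‖ ^ 2) ^ β := Real.rpow_nonneg (one_sub_norm_sq_pos hz).le _
  have hlog : Real.log m ≤ 2 * Real.log n := by
    rw [show (2 : ℝ) * Real.log n = ((2 : ℕ) : ℝ) * Real.log n by norm_num, ← Real.log_pow]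
    refine Real.log_le_log (by exact_mod_cast (by omega : 0 < m)) ?_
    exact_mod_cast (by nlinarith : m ≤ n ^ 2)
  have hlog0 : 0 ≤ Real.log n := Real.log_natCast_nonneg n
  calc _ ≤ 2 * Real.log n * ((1 - ‖z‖ ^ 2) ^ β * ‖deriv g z‖ * ‖φ z‖ ^ (2 * n)) := by
        gcongr ?_ * (_ * ?_)
        exact pow_le_pow_of_le_one (norm_nonneg _) (hT.norm_lt_one hz).le hnm
    _ ≤ _ := by linarith

end IsVolterraComp

/-! ### Assembling the two-sided estimates. -/

/-- Two-sided comparison of extended reals from one-sided implications at every finite level. -/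
theorem ENNReal.exists_comparison {ι : Type*} {P : ι → Prop} {X L : ι → ℝ≥0∞} {a b : ℝ}
    (ha : 0 < a) (hb : 0 < b)
    (hX : ∀ i, P i → ∀ c : ℝ, 0 < c → L i < ENNReal.ofReal c → X i ≤ ENNReal.ofReal (a * c))
    (hL : ∀ i, P i → ∀ c : ℝ, 0 < c → X i < ENNReal.ofReal c → L i ≤ ENNReal.ofReal (b * c)) :
    ∃ C₁ C₂ : ℝ≥0, 0 < C₁ ∧ 0 < C₂ ∧ ∀ i, P i → C₁ * X i ≤ L i ∧ L i ≤ C₂ * X i := by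
  lift a to ℝ≥0 using ha.le
  lift b to ℝ≥0 using hb.le
  have ha' : 0 < a := ha
  have hb' : 0 < b := hb
  refine ⟨a⁻¹, b, inv_pos.2 ha', hb', fun i hi => ⟨?_, ?_⟩⟩
  · have h := ENNReal.le_mul_of_forall_lt_ofReal ha' (hX i hi)
    calc ((a⁻¹ : ℝ≥0) : ℝ≥0∞) * X i ≤ ((a⁻¹ : ℝ≥0) : ℝ≥0∞) * (a * L i) := by gcongr
      _ = L i := by
        rw [← mul_assoc, ← ENNReal.coe_mul, inv_mul_cancel₀ ha'.ne', ENNReal.coe_one, one_mul]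
  · exact ENNReal.le_mul_of_forall_lt_ofReal hb' (hL i hi)

/-- The triples `(φ, g, T)` with `T` the bounded operator `V_g C_φ : 𝓩^α → 𝓩^β`. -/
structure VolterraCompData (α β : ℝ) where
  φ : ℂ → ℂ
  g : ℂ → ℂ
  T : Zygmund α →L[ℂ] Zygmund β

theorem exists_comparison_of_lt_one {α : ℝ} (β : ℝ) (hα : 0 < α) (hα1 : α < 1) :
    ∃ C₁ C₂ : ℝ≥0, 0 < C₁ ∧ 0 < C₂ ∧ ∀ d : VolterraCompData α β, IsVolterraComp d.g d.φ d.T →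
      C₁ * essNorm d.T ≤
          limsupPow β (fun n => ((n : ℝ) + 1) ^ α) (fun z => d.g z * deriv d.φ z) d.φ ∧
      limsupPow β (fun n => ((n : ℝ) + 1) ^ α) (fun z => d.g z * deriv d.φ z) d.φ ≤
          C₂ * essNorm d.T := by
  refine ENNReal.exists_comparison (a := 6 * (2 * 2 ^ α))
    (b := monomialConst α + derivSymbolConst α) (by positivity)
    (add_pos (monomialConst_pos hα) (derivSymbolConst_pos hα))
    (fun d hd c hc h => ?_) (fun d hd c hc h => hd.limsupPow_symbol_le hα hc h)
  exact (hd.essNorm_le_of_lt_one hα hα1 hc h).trans_eq (by ring_nf)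

theorem exists_comparison_one (β : ℝ) :
    ∃ C₁ C₂ : ℝ≥0, 0 < C₁ ∧ 0 < C₂ ∧ ∀ d : VolterraCompData 1 β, IsVolterraComp d.g d.φ d.T →
      C₁ * essNorm d.T ≤
          max (limsupPow β (fun n => (n : ℝ) + 1) (fun z => d.g z * deriv d.φ z) d.φ)
            (limsupPow β (fun n => Real.log n) (deriv d.g) d.φ) ∧
      max (limsupPow β (fun n => (n : ℝ) + 1) (fun z => d.g z * deriv d.φ z) d.φ)
            (limsupPow β (fun n => Real.log n) (deriv d.g) d.φ) ≤
          C₂ * essNorm d.T := by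
  have hE := add_pos (monomialConst_pos one_pos) (derivSymbolConst_pos one_pos)
  refine ENNReal.exists_comparison (a := 36)
    (b := 2 * (14 + 48 * (monomialConst 1 + derivSymbolConst 1))) (by norm_num) (by positivity)
    (fun d hd c hc h => ?_) (fun d hd c hc h => ?_)
  · obtain ⟨h1, h2⟩ := max_lt_iff.1 h
    exact hd.essNorm_le_of_eq_one hc h1 h2
  · refine max_le ?_ (hd.limsupPow_log_le hc h)
    have h1 := hd.limsupPow_symbol_le one_pos hc h
    simp only [Real.rpow_one] at h1
    refine h1.trans (ENNReal.ofReal_le_ofReal ?_)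
    gcongr
    linarith

theorem exists_comparison_of_one_lt {α : ℝ} (β : ℝ) (hα1 : 1 < α) :
    ∃ C₁ C₂ : ℝ≥0, 0 < C₁ ∧ 0 < C₂ ∧ ∀ d : VolterraCompData α β, IsVolterraComp d.g d.φ d.T →
      C₁ * essNorm d.T ≤
          max (limsupPow β (fun n => ((n : ℝ) + 1) ^ α) (fun z => d.g z * deriv d.φ z) d.φ)
            (limsupPow β (fun n => ((n : ℝ) + 1) ^ (α - 1)) (deriv d.g) d.φ) ∧
      max (limsupPow β (fun n => ((n : ℝ) + 1) ^ α) (fun z => d.g z * deriv d.φ z) d.φ)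
            (limsupPow β (fun n => ((n : ℝ) + 1) ^ (α - 1)) (deriv d.g) d.φ) ≤
          C₂ * essNorm d.T := by
  have hα : 0 < α := by linarith
  have hα' : 0 < α - 1 := by linarith
  have hD := monomialConst_pos hα
  refine ENNReal.exists_comparison
    (a := 6 * (2 * 2 ^ α + 2 * 2 ^ (α - 1) * 2 ^ (α - 1) / (α - 1)))
    (b := monomialConst α + derivSymbolConst α) (by positivity)
    (add_pos hD (derivSymbolConst_pos hα))
    (fun d hd c hc h => ?_) (fun d hd c hc h => ?_)
  · obtain ⟨h1, h2⟩ := max_lt_iff.1 h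
    exact (hd.essNorm_le_of_one_lt hα1 hc h1 h2).trans_eq (by ring_nf)
  · refine max_le (hd.limsupPow_symbol_le hα hc h) ((hd.limsupPow_deriv_symbol_le hα hc h).trans
      (ENNReal.ofReal_le_ofReal ?_))
    gcongr
    linarith

theorem theorem3p1 (α β : ℝ) (hα : 0 < α) (hβ : 0 < β) :
    ∃ C₁ C₂ : ℝ≥0, 0 < C₁ ∧ 0 < C₂ ∧
      ∀ (φ g : ℂ → ℂ),
        DifferentiableOn ℂ φ (ball 0 1) → Set.MapsTo φ (ball 0 1) (ball 0 1) →
        DifferentiableOn ℂ g (ball 0 1) →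
      -- `T` is the bounded operator `V_g C_φ : 𝓩^α → 𝓩^β`
      ∀ T : Zygmund α →L[ℂ] Zygmund β,
        (∀ f : Zygmund α, ∀ z ∈ ball (0 : ℂ) 1, T f z = volterraComp g φ f z) →
      (α < 1 →
        C₁ * essNorm T ≤
            limsupPow β (fun n => ((n : ℝ) + 1) ^ α) (fun z => g z * deriv φ z) φ ∧
        limsupPow β (fun n => ((n : ℝ) + 1) ^ α) (fun z => g z * deriv φ z) φ ≤
            C₂ * essNorm T) ∧
      (α = 1 →
        C₁ * essNorm T ≤
            max (limsupPow β (fun n => (n : ℝ) + 1) (fun z => g z * deriv φ z) φ)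
              (limsupPow β (fun n => Real.log n) (deriv g) φ) ∧
        max (limsupPow β (fun n => (n : ℝ) + 1) (fun z => g z * deriv φ z) φ)
              (limsupPow β (fun n => Real.log n) (deriv g) φ) ≤
            C₂ * essNorm T) ∧
      (1 < α →
        C₁ * essNorm T ≤
            max (limsupPow β (fun n => ((n : ℝ) + 1) ^ α) (fun z => g z * deriv φ z) φ)
              (limsupPow β (fun n => ((n : ℝ) + 1) ^ (α - 1)) (deriv g) φ) ∧
        max (limsupPow β (fun n => ((n : ℝ) + 1) ^ α) (fun z => g z * deriv φ z) φ)
              (limsupPow β (fun n => ((n : ℝ) + 1) ^ (α - 1)) (deriv g) φ) ≤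
            C₂ * essNorm T) := by
  rcases lt_trichotomy α 1 with h | h | h
  · obtain ⟨C₁, C₂, h₁, h₂, hC⟩ := exists_comparison_of_lt_one β hα h
    refine ⟨C₁, C₂, h₁, h₂, fun φ g hφ hm hg T hT => ⟨fun _ => hC ⟨φ, g, T⟩ ⟨hφ, hm, hg, hT⟩,
      fun h' => absurd h' h.ne, fun h' => absurd h' h.le.not_gt⟩⟩
  · subst h
    obtain ⟨C₁, C₂, h₁, h₂, hC⟩ := exists_comparison_one β
    exact ⟨C₁, C₂, h₁, h₂, fun φ g hφ hm hg T hT => ⟨fun h' => absurd h' (lt_irrefl _),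
      fun _ => hC ⟨φ, g, T⟩ ⟨hφ, hm, hg, hT⟩, fun h' => absurd h' (lt_irrefl _)⟩⟩
  · obtain ⟨C₁, C₂, h₁, h₂, hC⟩ := exists_comparison_of_one_lt β h
    exact ⟨C₁, C₂, h₁, h₂, fun φ g hφ hm hg T hT => ⟨fun h' => absurd h' h.le.not_gt,
      fun h' => absurd h' h.ne', fun _ => hC ⟨φ, g, T⟩ ⟨hφ, hm, hg, hT⟩⟩⟩
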